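/- Let $\ell\ge 1$ and $b,u\ge 0$ be integers, and write $[n]=\{1,\dots,n\}$. \emph{Pebble trees.} A tree is either a leaf or a node with a nonempty ordered list of subtrees (its children). A pebble tree with colors $[b+u]$ is a tree with colored pebbles placed on its nodes (none on leaves, several pebbles of the same color being allowed on a node) such that each node with a single child carries at least one pebble and, for each subtree $S$ (rooted at a node or at a leaf) and each color $c$, the number of leaves of $S$ minus the number of pebbles of color $c$ in $S$ is $0$ ($S$ is $c$-balanced) or $1$ ($S$ is $c$-unbalanced). Let $\mathcal{PT}_\ell^{b,u}$ be the set of pebble trees with $\ell$ leaves, labeled $1,\dots,\ell$ from left to right, that are $c$-balanced for $c\in[b]$ and $c$-unbalanced for $c\in[b+1,b+u]$. Contracting a node (neither a leaf nor the root) replaces it by its children in the list of children of its parent and adds its pebbles to its parent. The pebble tree contraction poset is $\mathcal{PT}_\ell^{b,u}$ ordered by $T'\le T$ if and only if $T'$ is obtained from $T$ by a (possibly empty) sequence of contractions. \emph{Vectors and cones.} Let $I=[\ell(b+u+1)-1]$, $I_0=[\ell(b+1)-1]$, $I_i=[\ell(b+i),\ell(b+i+1)-1]$ for $i\in[u]$,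 and $$\mathbb{H}_\ell^{b,u}=\Big\{x\in\mathbb{R}^I : \sum_{j\in I_i}x_j=0\text{ for all }0\le i\le u\Big\}.$$ For $J\subseteq I$ let $r_J=\sum_{i=0}^{u}\big(|I_i\setminus J|\,\mathbf{1}_{I_i\cap J}-|I_i\cap J|\,\mathbf{1}_{I_i\setminus J}\big)$, where $\mathbf 1_K$ is the characteristic vector of $K$. For a subtree $S$ of $T\in\mathcal{PT}_\ell^{b,u}$ with set of leaves $[s,t]$ and set $B(S)$ of colors $c$ such that $S$ is $c$-balanced, let $\lambda(S)=[s,t-1]\cup\bigcup_{p\in B(S)}[\ell p+s-1,\ell p+t-1]$. Let $C(T)$ be the cone generated by the vectors $r_{\lambda(S)}$ for all subtrees $S$ of $T$. \emph{Theorem.} The collection $\mathcal F=\{C(T) : T\in\mathcal{PT}_\ell^{b,u}\}$ is an essential complete simplicial fan in $\mathbb{H}_\ell^{b,u}$, whose face lattice is the pebble tree contraction poset. That is: $\mathcal F$ is a finite set of polyhedral cones, every face of a cone of $\mathcal F$ (its intersection with the kernel of a linear form nonnegative on it) belongs to $\mathcal F$, and any two cones of $\mathcal F$ intersect along a face of both;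 the intersection of all cones of $\mathcal F$ is $\{0\}$; the union of all cones of $\mathcal F$ is $\mathbb{H}_\ell^{b,u}$; each cone of $\mathcal F$ is generated by linearly independent vectors; and $T\mapsto C(T)$ is an isomorphism of posets from the pebble tree contraction poset to $\mathcal F$ ordered by inclusion. -/

import Mathlib

/-! ### Pebble trees -/

/-- Ordered trees whose nodes carry pebbles coloured by `κ`: a tree is a leaf, or a node carrying
`p c` pebbles of each colour `c`, with an ordered list of children. -/
inductive PTree (κ : Type) : Type
  | leaf : PTree κ
  | node (p : κ → ℕ) (children : List (PTree κ)) : PTree κ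

namespace PTree

variable {κ : Type}

/-- The number of leaves of a tree. -/
def leaves : PTree κ → ℕ
  | leaf => 1
  | node _ cs => (cs.map leaves).sum

/-- The number of nodes of a tree (leaves are not nodes). -/
def nodes : PTree κ → ℕ
  | leaf => 0
  | node _ cs => 1 + (cs.map nodes).sum

/-- The number of pebbles of colour `c` in a tree. -/
def pebbles (c : κ) : PTree κ → ℕ
  | leaf => 0
  | node p cs => p c + (cs.map (pebbles c)).sum

/-- The `c`-pebble default: the number of leaves minus the number of `c`-pebbles. -/
def pebbleDefault (c : κ) (T : PTree κ) : ℤ := (T.leaves : ℤ) - (T.pebbles c : ℤ)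

/-- The conditions defining a pebble tree.  Every node has at least one child, a node with a single
child has at least one pebble, and for every subtree and every colour the pebble default is `0`
or `1` (for a leaf it is always `1`). -/
def IsPebbleTree : PTree κ → Prop
  | leaf => True
  | node p cs => cs ≠ [] ∧ (cs.length = 1 → ∃ c, 1 ≤ p c) ∧
      (∀ c, pebbleDefault c (node p cs) = 0 ∨ pebbleDefault c (node p cs) = 1) ∧
      ∀ C ∈ cs, IsPebbleTree C

/-- `IsSubtreeAt T s S t`: if the leaves of `T` are numbered from left to right by `s, s+1, …`,
then `S` is the subtree of `T` rooted at some node or leaf of `T`, and its leaves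
are numbered `t, t+1, …`. -/
inductive IsSubtreeAt : PTree κ → ℕ → PTree κ → ℕ → Prop
  | refl (T : PTree κ) (s : ℕ) : IsSubtreeAt T s T s
  | child {p : κ → ℕ} {pre post : List (PTree κ)} {C S : PTree κ} {s t : ℕ}
      (h : IsSubtreeAt C (s + (pre.map leaves).sum) S t) :
      IsSubtreeAt (node p (pre ++ C :: post)) s S t

/-- `Contracts T T'`: `T'` is the contraction `T/c` of a node `c` (neither a leaf nor the root)
of `T`, that is, `c` is replaced by its children in the list of children of its parent, and its
pebbles are added to those of its parent. -/
inductive Contracts : PTree κ → PTree κ → Prop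
  | here (p q : κ → ℕ) (pre cs post : List (PTree κ)) :
      Contracts (node p (pre ++ node q cs :: post)) (node (p + q) (pre ++ cs ++ post))
  | inside (p : κ → ℕ) (pre post : List (PTree κ)) {C C' : PTree κ} (h : Contracts C C') :
      Contracts (node p (pre ++ C :: post)) (node p (pre ++ C' :: post))

theorem Contracts.nodes_lt {T T' : PTree κ} (h : Contracts T T') : T'.nodes < T.nodes := by
  induction h with
  | here p q pre cs post => simp [nodes]
  | inside p pre post h ih => simp [nodes, ih]

theorem nodes_le_of_contractions {T T' : PTree κ} (h : Relation.ReflTransGen Contracts T T') :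
    T = T' ∨ T'.nodes < T.nodes := by
  induction h with
  | refl => exact Or.inl rfl
  | tail _ hc ih =>
    rcases ih with rfl | ih
    · exact Or.inr hc.nodes_lt
    · exact Or.inr (hc.nodes_lt.trans ih)

end PTree

/-- The pebble trees with leaves `[ℓ]`, balanced colours `[b]` and unbalanced colours
`[b+1, b+u]`.  The colour `p ∈ [b+u]` is represented by the element `p - 1` of `Fin (b + u)`. -/
def PebbleTree (ℓ b u : ℕ) : Type :=
  {T : PTree (Fin (b + u)) // T.IsPebbleTree ∧ T.leaves = ℓ ∧
    ∀ c : Fin (b + u), T.pebbleDefault c = if (c : ℕ) < b then 0 else 1}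

/-- The pebble tree contraction poset: `S ≤ T` when `S` is obtained from `T` by a (possibly empty)
sequence of contractions. -/
instance PebbleTree.instPartialOrder (ℓ b u : ℕ) : PartialOrder (PebbleTree ℓ b u) where
  le S T := Relation.ReflTransGen PTree.Contracts T.1 S.1
  le_refl _ := Relation.ReflTransGen.refl
  le_trans _ _ _ h₁ h₂ := Relation.ReflTransGen.trans h₂ h₁
  le_antisymm S T h₁ h₂ := by
    apply Subtype.ext
    rcases PTree.nodes_le_of_contractions h₁ with h | h
    · exact h.symm
    · rcases PTree.nodes_le_of_contractions h₂ with h' | h'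
      · exact h'
      · omega

/-! ### Cones and fans -/

section Fans

variable {E : Type} [AddCommGroup E] [Module ℝ E]

/-- `D` is a face of the cone `C`: the intersection of `C` with the kernel of a linear form that is
nonnegative on `C` (the zero form gives `C` itself). -/
def IsConeFace (D C : PointedCone ℝ E) : Prop :=
  ∃ φ : E →ₗ[ℝ] ℝ, (∀ x ∈ C, 0 ≤ φ x) ∧ ∀ x, x ∈ D ↔ x ∈ C ∧ φ x = 0

/-- A (polyhedral) fan: a finite set of polyhedral cones, closed under taking faces, any two of
which intersect along a face of both. -/
structure IsFan (F : Set (PointedCone ℝ E)) : Prop where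
  finite : F.Finite
  polyhedral : ∀ C ∈ F, C.FG
  face_mem : ∀ C ∈ F, ∀ D, IsConeFace D C → D ∈ F
  inter_face : ∀ C ∈ F, ∀ D ∈ F, IsConeFace (C ⊓ D) C ∧ IsConeFace (C ⊓ D) D

/-- The cones of `F` lie in the linear subspace `H` and cover it. -/
def IsCompleteIn (F : Set (PointedCone ℝ E)) (H : Submodule ℝ E) : Prop :=
  (⋃ C ∈ F, (C : Set E)) = (H : Set E)

/-- The intersection of the cones of `F` is the origin. -/
def IsEssentialFan (F : Set (PointedCone ℝ E)) : Prop :=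
  (⋂ C ∈ F, (C : Set E)) = {0}

/-- All cones of `F` are generated by linearly independent vectors. -/
def IsSimplicialFan (F : Set (PointedCone ℝ E)) : Prop :=
  ∀ C ∈ F, C.IsSimplicial

end Fans

/-! ### The pebble tree fan -/

namespace PebbleTree

/-- The set `[s,t] ⊠ B = [s,t-1] ∪ ⋃_{p ∈ B} [ℓp+s-1, ℓp+t-1]`; the element `c` of `Fin n` stands
for the colour `p = c + 1`. -/
def box (ℓ : ℕ) {n : ℕ} (s t : ℕ) (B : Finset (Fin n)) : Finset ℕ :=
  Finset.Icc s (t - 1) ∪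
    B.biUnion fun c => Finset.Icc (ℓ * ((c : ℕ) + 1) + s - 1) (ℓ * ((c : ℕ) + 1) + t - 1)

/-- The set of colours for which `S` is balanced. -/
def balanced {n : ℕ} (S : PTree (Fin n)) : Finset (Fin n) :=
  Finset.univ.filter fun c => S.pebbleDefault c = 0

/-- The set `λ(S) = L(S) ⊠ B(S)` of a subtree `S` whose leaves are numbered `s, s+1, …`. -/
def code (ℓ : ℕ) {n : ℕ} (S : PTree (Fin n)) (s : ℕ) : Finset ℕ :=
  box ℓ s (s + S.leaves - 1) (balanced S)

/-- The interval `I = [ℓ(b+u+1)-1]` indexing the coordinates. -/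
abbrev Idx (ℓ b u : ℕ) : Type := ↥(Finset.Icc 1 (ℓ * (b + u + 1) - 1))

/-- The intervals `I_0 = [ℓ(b+1)-1]` and `I_i = [ℓ(b+i), ℓ(b+i+1)-1]` for `i ≥ 1`. -/
def block (ℓ b i : ℕ) : Finset ℕ :=
  if i = 0 then Finset.Icc 1 (ℓ * (b + 1) - 1)
  else Finset.Icc (ℓ * (b + i)) (ℓ * (b + i + 1) - 1)

/-- The characteristic vector of `J`. -/
def charVec (ℓ b u : ℕ) (J : Finset ℕ) : Idx ℓ b u → ℝ :=
  fun j => if (j : ℕ) ∈ J then 1 else 0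

/-- The subspace of the vectors `x` with `⟨𝟙_{I_i}, x⟩ = 0` for all `0 ≤ i ≤ u`. -/
def space (ℓ b u : ℕ) : Submodule ℝ (Idx ℓ b u → ℝ) where
  carrier := {x | ∀ i ≤ u, charVec ℓ b u (block ℓ b i) ⬝ᵥ x = 0}
  zero_mem' := fun i _ => by simp
  add_mem' := fun {x y} hx hy i hi => by simp [dotProduct_add, hx i hi, hy i hi]
  smul_mem' := fun a x hx i hi => by simp [dotProduct_smul, hx i hi]

/-- The vector
`r_J = ∑_{0 ≤ i ≤ u} (|I_i ∖ J| • 𝟙_{I_i ∩ J} - |I_i ∩ J| • 𝟙_{I_i ∖ J})`. -/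
def ray (ℓ b u : ℕ) (J : Finset ℕ) : Idx ℓ b u → ℝ :=
  ∑ i ∈ Finset.range (u + 1),
    (((block ℓ b i \ J).card : ℝ) • charVec ℓ b u (block ℓ b i ∩ J)
      - ((block ℓ b i ∩ J).card : ℝ) • charVec ℓ b u (block ℓ b i \ J))

/-- The cone generated by the vectors `r_{λ(S)}` for all subtrees `S` of `T`, where the leaves of
`T` are numbered `1, …, ℓ` from left to right. -/
def cone {ℓ b u : ℕ} (T : PebbleTree ℓ b u) : PointedCone ℝ (Idx ℓ b u → ℝ) :=
  PointedCone.hull ℝ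
    {r | ∃ (S : PTree (Fin (b + u))) (s : ℕ), T.1.IsSubtreeAt 1 S s ∧ r = ray ℓ b u (code ℓ S s)}

/-- The pebble tree fan: the collection of the cones of all pebble trees. -/
def fan (ℓ b u : ℕ) : Set (PointedCone ℝ (Idx ℓ b u → ℝ)) :=
  Set.range fun T : PebbleTree ℓ b u => T.cone

end PebbleTree

/-! ### Fans from unique positive decompositions -/

section UniqueDecompositions

variable {E : Type} [AddCommGroup E] [Module ℝ E] {ι P : Type*}

-- The fan properties reduce to combinatorics. Attach to each member of a poset a finite set of
-- generators, monotonically, so that every subset of the set of T is the set of some S ≤ T. If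
-- positive combinations over these sets determine both the member and the weights
-- (`UniqueDecompositions`), then linear independence, the description of faces and intersections,
-- and the order isomorphism all follow by comparing supports of nonnegative combinations.
--
-- For pebble trees the generators are the boxes (interval of leaves, set of balanced colours) of
-- the nodes other than the root: the rays of the root and of the leaves are zero. A contraction
-- deletes exactly one such box, so the trees below T realize all subsets of its boxes.
--
-- A box is viewed as the indicator of a set of coordinates: gaps between consecutive leaves, and
-- pairs (colour, leaf). The map `toSpace` sends this indicator to the ray, and its kernel consists
-- of the vectors that are constant on each block `I_i`. Modulo such constants, a vector has a
-- unique nonnegative representative with a zero in each nonempty block. A positive combination of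
-- non-root boxes is already normalized: two consecutive children leave a gap uncovered, a single
-- child comes with a pebble whose colour is unbalanced in that child, and a subtree unbalanced in a
-- colour has a leaf that no box covers in that colour. Equality of ray combinations thus lifts to
-- equality of nonnegative vectors.
--
-- Such a vector X determines its tree (`determinedBy`): its vanishing gaps separate the children, a
-- child is balanced exactly in the colours where X is positive on all its leaves, and an uncovered
-- coordinate of the child's box reveals the weight of its root. Run as an algorithm, this
-- decomposes every nonnegative X (`forestDecomposition`): cut at a vanishing gap, subtract the
-- minimum over the root box, and repeat on a smaller support. This gives completeness.

theorem PointedCone.mem_hull_image_finset {v : ι → E} {s : Finset ι} {x : E} :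
    x ∈ PointedCone.hull ℝ (v '' (s : Set ι)) ↔
      ∃ w : ι → ℝ, (∀ i ∈ s, 0 ≤ w i) ∧ ∑ i ∈ s, w i • v i = x := by
  classical
  rw [Submodule.mem_span_image_finset_iff_exists_fun]
  constructor
  · rintro ⟨w, rfl⟩
    refine ⟨fun i => if h : i ∈ s then w ⟨i, h⟩ else 0, fun i hi => ?_, ?_⟩
    · simpa only [hi, dite_true] using (w ⟨i, hi⟩).2
    · rw [← Finset.sum_coe_sort]
      refine Finset.sum_congr rfl fun i _ => ?_
      simp only [i.2, dite_true]
      rfl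
  · rintro ⟨w, hw, rfl⟩
    refine ⟨fun i => ⟨w i, hw i i.2⟩, ?_⟩
    rw [← Finset.sum_coe_sort s]
    rfl

/-- A family of finite sets of generators, indexed by a poset, such that the linear combinations
with positive coefficients of these sets are pairwise distinct. -/
structure UniqueDecompositions [PartialOrder P] (N : P → Finset ι) (v : ι → E) : Prop where
  mono : ∀ ⦃S T⦄, S ≤ T → N S ⊆ N T
  exists_le : ∀ T X, X ⊆ N T → ∃ S ≤ T, N S = X
  unique : ∀ S T (w w' : ι → ℝ), (∀ i ∈ N S, 0 < w i) → (∀ i ∈ N T, 0 < w' i) →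
    ∑ i ∈ N S, w i • v i = ∑ i ∈ N T, w' i • v i → S = T ∧ ∀ i ∈ N S, w i = w' i

namespace UniqueDecompositions

variable [PartialOrder P] {N : P → Finset ι} {v : ι → E}

/-- The cone generated by the vectors indexed by `N T`. -/
def coneOf (N : P → Finset ι) (v : ι → E) (T : P) : PointedCone ℝ E :=
  PointedCone.hull ℝ (v '' (N T : Set ι))

theorem exists_pos (h : UniqueDecompositions N v) {T : P} {w : ι → ℝ} (hw : ∀ i ∈ N T, 0 ≤ w i) :
    ∃ S ≤ T, (∀ i, i ∈ N S ↔ i ∈ N T ∧ 0 < w i) ∧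
      ∑ i ∈ N S, w i • v i = ∑ i ∈ N T, w i • v i := by
  classical
  obtain ⟨S, hST, hS⟩ := h.exists_le T ((N T).filter fun i => 0 < w i) (Finset.filter_subset _ _)
  refine ⟨S, hST, fun i => by simp [hS], ?_⟩
  rw [hS]
  refine Finset.sum_subset (Finset.filter_subset _ _) fun i hi hi' => ?_
  have : w i = 0 := by
    simp only [Finset.mem_filter, hi, true_and, not_lt] at hi'
    exact le_antisymm hi' (hw i hi)
  simp [this]

/-- Discarding the zero weights leaves positive combinations of smaller members, to which uniqueness
applies. -/
theorem eq_of_nonneg (h : UniqueDecompositions N v) {S T : P} {w w' : ι → ℝ}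
    (hw : ∀ i ∈ N S, 0 ≤ w i) (hw' : ∀ i ∈ N T, 0 ≤ w' i)
    (he : ∑ i ∈ N S, w i • v i = ∑ i ∈ N T, w' i • v i) :
    (∀ i ∈ N S, 0 < w i → i ∈ N T ∧ w i = w' i) := by
  obtain ⟨S', hS', hm, hs⟩ := h.exists_pos hw
  obtain ⟨T', hT', hm', hs'⟩ := h.exists_pos hw'
  obtain ⟨rfl, hww⟩ := h.unique S' T' w w' (fun i hi => ((hm i).1 hi).2)
    (fun i hi => ((hm' i).1 hi).2) (hs.trans (he.trans hs'.symm))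
  intro i hi hpos
  have hi' : i ∈ N S' := (hm i).2 ⟨hi, hpos⟩
  exact ⟨h.mono hT' hi', hww i hi'⟩

theorem linearIndepOn (h : UniqueDecompositions N v) (T : P) :
    LinearIndepOn ℝ v (N T : Set ι) := by
  rw [linearIndepOn_finset_iff]
  intro f hf i hi
  -- A linear relation is an equality between its positive and negative parts; these have disjoint
  -- supports, so by uniqueness both vanish.
  have hsum : ∑ i ∈ N T, max (f i) 0 • v i = ∑ i ∈ N T, max (-f i) 0 • v i := by
    rw [← sub_eq_zero, ← Finset.sum_sub_distrib, ← hf]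
    refine Finset.sum_congr rfl fun j _ => ?_
    rw [← sub_smul]
    congr 1
    rcases le_total 0 (f j) with h0 | h0
    · rw [max_eq_left h0, max_eq_right (by linarith)]; ring
    · rw [max_eq_right h0, max_eq_left (by linarith)]; ring
  have key := h.eq_of_nonneg (fun j _ => le_max_right (f j) 0)
    (fun j _ => le_max_right (-f j) 0) hsum i hi
  have key' := h.eq_of_nonneg (fun j _ => le_max_right (-f j) 0)
    (fun j _ => le_max_right (f j) 0) hsum.symm i hi
  rcases lt_trichotomy (f i) 0 with h0 | h0 | h0
  · have := (key' (lt_max_of_lt_left (by linarith))).2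
    rw [max_eq_left (by linarith), max_eq_right h0.le] at this
    linarith
  · exact h0
  · have := (key (lt_max_of_lt_left h0)).2
    rw [max_eq_left h0.le, max_eq_right (by linarith)] at this
    linarith

theorem exists_form (h : UniqueDecompositions N v) (T : P) (f : ι → ℝ) :
    ∃ φ : E →ₗ[ℝ] ℝ, ∀ i ∈ N T, φ (v i) = f i := by
  have hli : LinearIndependent ℝ fun i : (N T : Set ι) => v i := h.linearIndepOn T
  obtain ⟨φ, hφ⟩ := LinearMap.exists_extend
    ((Module.Basis.span hli).constr ℝ fun i : (N T : Set ι) => f i)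
  refine ⟨φ, fun i hi => ?_⟩
  have h1 := LinearMap.congr_fun hφ (Module.Basis.span hli ⟨i, hi⟩)
  rw [Module.Basis.constr_basis] at h1
  simpa [Module.Basis.span_apply] using h1

theorem isConeFace_of_le (h : UniqueDecompositions N v) {S T : P} (hST : S ≤ T) :
    IsConeFace (coneOf N v S) (coneOf N v T) := by
  classical
  -- By linear independence, a form can be prescribed on the generators of T; this one exposes the
  -- face spanned by those of S.
  obtain ⟨φ, hφ⟩ := h.exists_form T fun i => if i ∈ N S then 0 else 1
  have hval : ∀ w : ι → ℝ, φ (∑ i ∈ N T, w i • v i) = ∑ i ∈ N T, if i ∈ N S then 0 else w i := by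
    intro w
    rw [map_sum]
    refine Finset.sum_congr rfl fun i hi => ?_
    rw [map_smul, hφ i hi]
    split_ifs <;> simp
  have hnn : ∀ w : ι → ℝ, (∀ i ∈ N T, 0 ≤ w i) → ∀ i ∈ N T, 0 ≤ if i ∈ N S then 0 else w i := by
    intro w hw i hi
    split_ifs
    · exact le_rfl
    · exact hw i hi
  refine ⟨φ, fun x hx => ?_, fun x => ⟨fun hx => ⟨?_, ?_⟩, fun ⟨hx, h0⟩ => ?_⟩⟩
  · obtain ⟨w, hw, rfl⟩ := PointedCone.mem_hull_image_finset.1 hx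
    rw [hval]
    exact Finset.sum_nonneg (hnn w hw)
  · exact Submodule.span_mono (Set.image_mono (by exact_mod_cast h.mono hST)) hx
  · obtain ⟨w, hw, rfl⟩ := PointedCone.mem_hull_image_finset.1 hx
    rw [map_sum]
    refine Finset.sum_eq_zero fun i hi => ?_
    rw [map_smul, hφ i (h.mono hST hi), if_pos hi, smul_zero]
  · obtain ⟨w, hw, rfl⟩ := PointedCone.mem_hull_image_finset.1 hx
    rw [hval, Finset.sum_eq_zero_iff_of_nonneg (hnn w hw)] at h0
    refine PointedCone.mem_hull_image_finset.2 ⟨w, fun i hi => hw i (h.mono hST hi), ?_⟩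
    refine Finset.sum_subset (h.mono hST) fun i hi hi' => ?_
    have := h0 i hi
    rw [if_neg hi'] at this
    simp [this]

theorem exists_of_isConeFace (h : UniqueDecompositions N v) {T : P} {D : PointedCone ℝ E}
    (hD : IsConeFace D (coneOf N v T)) : ∃ S ≤ T, coneOf N v S = D := by
  classical
  obtain ⟨φ, hφ, hmem⟩ := hD
  -- A face of a finitely generated cone is generated by the generators on which its form vanishes.
  obtain ⟨S, hST, hS⟩ := h.exists_le T ((N T).filter fun i => φ (v i) = 0) (Finset.filter_subset _ _)
  have hv : ∀ i ∈ N T, 0 ≤ φ (v i) := fun i hi =>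
    hφ _ (Submodule.subset_span (Set.mem_image_of_mem v hi))
  refine ⟨S, hST, SetLike.ext fun x => ?_⟩
  rw [hmem]
  constructor
  · intro hx
    refine ⟨Submodule.span_mono (Set.image_mono (by exact_mod_cast h.mono hST)) hx, ?_⟩
    obtain ⟨w, hw, rfl⟩ := PointedCone.mem_hull_image_finset.1 hx
    rw [map_sum]
    refine Finset.sum_eq_zero fun i hi => ?_
    rw [hS, Finset.mem_filter] at hi
    rw [map_smul, hi.2, smul_zero]
  · rintro ⟨hx, h0⟩
    obtain ⟨w, hw, rfl⟩ := PointedCone.mem_hull_image_finset.1 hx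
    simp only [map_sum, map_smul, smul_eq_mul] at h0
    rw [Finset.sum_eq_zero_iff_of_nonneg fun i hi => mul_nonneg (hw i hi) (hv i hi)] at h0
    refine PointedCone.mem_hull_image_finset.2 ⟨w, fun i hi => hw i (h.mono hST hi), ?_⟩
    refine Finset.sum_subset (h.mono hST) fun i hi hi' => ?_
    rcases mul_eq_zero.1 (h0 i hi) with h1 | h1
    · simp [h1]
    · exact absurd (by rw [hS]; exact Finset.mem_filter.2 ⟨hi, h1⟩) hi'

theorem exists_inf (h : UniqueDecompositions N v) (S T : P) :
    ∃ R, R ≤ S ∧ R ≤ T ∧ coneOf N v S ⊓ coneOf N v T = coneOf N v R := by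
  classical
  have hinj : ∀ R R', N R = N R' → R = R' := fun R R' he =>
    (h.unique R R' (fun _ => 1) (fun _ => 1) (by simp) (by simp) (by rw [he])).1
  obtain ⟨R, hRS, hR⟩ := h.exists_le S (N S ∩ N T) Finset.inter_subset_left
  obtain ⟨R', hRT, hR'⟩ := h.exists_le T (N S ∩ N T) Finset.inter_subset_right
  obtain rfl := hinj R R' (hR.trans hR'.symm)
  refine ⟨R, hRS, hRT, le_antisymm ?_ (le_inf ?_ ?_)⟩
  · rintro x ⟨hx, hx'⟩
    obtain ⟨w, hw, rfl⟩ := PointedCone.mem_hull_image_finset.1 hx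
    obtain ⟨w', hw', he⟩ := PointedCone.mem_hull_image_finset.1 hx'
    refine PointedCone.mem_hull_image_finset.2 ⟨w, fun i hi => hw i (h.mono hRS hi), ?_⟩
    refine Finset.sum_subset (h.mono hRS) fun i hi hi' => ?_
    rcases (hw i hi).eq_or_lt with h0 | h0
    · simp [← h0]
    · refine absurd ?_ hi'
      rw [hR, Finset.mem_inter]
      exact ⟨hi, (h.eq_of_nonneg hw hw' he.symm i hi h0).1⟩
  · exact Submodule.span_mono (Set.image_mono (by exact_mod_cast h.mono hRS))
  · exact Submodule.span_mono (Set.image_mono (by exact_mod_cast h.mono hRT))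

theorem coneOf_le_coneOf (h : UniqueDecompositions N v) {S T : P} :
    coneOf N v S ≤ coneOf N v T ↔ S ≤ T := by
  refine ⟨fun hle => ?_, fun hle =>
    Submodule.span_mono (Set.image_mono (by exact_mod_cast h.mono hle))⟩
  -- The sum of all generators uses each of them positively, so its support inside the cone of T
  -- must be a member R ≤ T equal to S.
  have hx : ∑ i ∈ N S, (1 : ℝ) • v i ∈ coneOf N v T :=
    hle (PointedCone.mem_hull_image_finset.2 ⟨fun _ => 1, by simp, rfl⟩)
  obtain ⟨w, hw, he⟩ := PointedCone.mem_hull_image_finset.1 hx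
  obtain ⟨R, hRT, hm, hs⟩ := h.exists_pos hw
  obtain ⟨rfl, -⟩ := h.unique S R (fun _ => 1) w (by simp) (fun i hi => ((hm i).1 hi).2)
    (by rw [hs, he])
  exact hRT

theorem isFan (h : UniqueDecompositions N v) (hfin : (Set.range N).Finite) :
    IsFan (Set.range (coneOf N v)) where
  finite := by
    have : Set.range (coneOf N v) =
        (fun X : Finset ι => PointedCone.hull ℝ (v '' (X : Set ι))) '' Set.range N := by
      rw [← Set.range_comp]; rfl
    rw [this]
    exact hfin.image _
  polyhedral := by
    rintro _ ⟨T, rfl⟩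
    exact Submodule.fg_span ((N T).finite_toSet.image v)
  face_mem := by
    rintro _ ⟨T, rfl⟩ D hD
    obtain ⟨S, -, hS⟩ := h.exists_of_isConeFace hD
    exact ⟨S, hS⟩
  inter_face := by
    rintro _ ⟨S, rfl⟩ _ ⟨T, rfl⟩
    obtain ⟨R, hS, hT, he⟩ := h.exists_inf S T
    rw [he]
    exact ⟨h.isConeFace_of_le hS, h.isConeFace_of_le hT⟩

theorem isEssentialFan (h : UniqueDecompositions N v) (T : P) :
    IsEssentialFan (Set.range (coneOf N v)) := by
  obtain ⟨S, -, hS⟩ := h.exists_le T ∅ (Finset.empty_subset _)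
  refine Set.Subset.antisymm (fun x hx => ?_) ?_
  · have := Set.mem_iInter₂.1 hx (coneOf N v S) ⟨S, rfl⟩
    simpa [coneOf, hS] using this
  · rintro _ rfl
    exact Set.mem_iInter₂.2 fun C _ => C.zero_mem

theorem isSimplicialFan (h : UniqueDecompositions N v) :
    IsSimplicialFan (Set.range (coneOf N v)) := by
  rintro _ ⟨T, rfl⟩
  exact ⟨v '' (N T : Set ι), (N T).finite_toSet.image v, (h.linearIndepOn T).id_image, rfl⟩

theorem exists_orderIso (h : UniqueDecompositions N v) :
    ∃ e : P ≃o ↥(Set.range (coneOf N v)), ∀ T, (e T : PointedCone ℝ E) = coneOf N v T :=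
  ⟨(OrderEmbedding.ofMapLEIff (coneOf N v) fun _ _ => h.coneOf_le_coneOf).orderIso, fun _ => rfl⟩

end UniqueDecompositions

end UniqueDecompositions

/-! ### Boxes of the nodes of a tree -/

namespace PTree

@[elab_as_elim]
-- The recursor of a nested inductive type has a second motive for lists of trees; here it asserts
-- the property for every member.
theorem induction_children {κ : Type} {motive : PTree κ → Prop} (leaf : motive leaf)
    (node : ∀ p cs, (∀ C ∈ cs, motive C) → motive (node p cs)) (T : PTree κ) : motive T :=
  PTree.rec (motive_1 := motive) (motive_2 := fun cs => ∀ C ∈ cs, motive C) leaf node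
    (by simp) (fun C cs hC hcs => by simpa using ⟨hC, hcs⟩) T

theorem leaves_pos {κ : Type} {T : PTree κ} (hT : T.IsPebbleTree) : 0 < T.leaves := by
  induction T using induction_children with
  | leaf => simp [leaves]
  | node p cs ih =>
    rw [IsPebbleTree] at hT
    obtain ⟨C, hC⟩ := List.exists_mem_of_ne_nil cs hT.1
    rw [leaves]
    exact (ih C hC (hT.2.2.2 C hC)).trans_le
      (List.single_le_sum (by simp) _ (List.mem_map_of_mem hC))

theorem pebbleDefault_node {κ : Type} (p : κ → ℕ) (cs : List (PTree κ)) (c : κ) :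
    (node p cs).pebbleDefault c = (cs.map (pebbleDefault c)).sum - p c := by
  have h : (cs.map (pebbleDefault c)).sum =
      ((cs.map leaves).sum : ℤ) - (cs.map (pebbles c)).sum := by
    induction cs with
    | nil => simp
    | cons C cs ih => simp only [List.map_cons, List.sum_cons, ih, pebbleDefault]; push_cast; ring
  rw [h, pebbleDefault, leaves, pebbles]
  push_cast
  ring

theorem pebbleDefault_eq {κ : Type} {T : PTree κ} (hT : T.IsPebbleTree) (c : κ) :
    T.pebbleDefault c = 0 ∨ T.pebbleDefault c = 1 := by
  cases T with
  | leaf => right; simp [pebbleDefault, leaves, pebbles]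
  | node p cs => rw [IsPebbleTree] at hT; exact hT.2.2.1 c

end PTree

namespace PebbleTree

/-- The coordinates `(none, j)` stand for the gap between the leaves `j` and `j + 1`, the
coordinates `(some c, j)` for the leaf `j` in the colour `c`. -/
abbrev Coord (n : ℕ) : Type := Option (Fin n) × ℕ

/-- An interval of leaves together with a set of colours. -/
@[ext]
structure Box (n : ℕ) where
  start : ℕ
  len : ℕ
  colors : Finset (Fin n)

variable {n : ℕ}

namespace Box

/-- The coordinates covered by a box. -/
def coords (τ : Box n) : Set (Coord n) :=
  {q | τ.start ≤ q.2 ∧ q.2 < τ.start + τ.len ∧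
    ((q.1 = none ∧ q.2 + 1 < τ.start + τ.len) ∨ ∃ c ∈ τ.colors, q.1 = some c)}

theorem none_mem_coords {τ : Box n} {j : ℕ} :
    (none, j) ∈ τ.coords ↔ τ.start ≤ j ∧ j + 1 < τ.start + τ.len := by
  simp [coords]; omega

theorem some_mem_coords {τ : Box n} {c : Fin n} {j : ℕ} :
    (some c, j) ∈ τ.coords ↔ c ∈ τ.colors ∧ τ.start ≤ j ∧ j < τ.start + τ.len := by
  simp [coords]; tauto

/-- The characteristic vector of a box. -/
noncomputable def ind (τ : Box n) : Coord n → ℝ := τ.coords.indicator 1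

theorem ind_nonneg (τ : Box n) (q : Coord n) : 0 ≤ τ.ind q :=
  Set.indicator_nonneg (by simp) q

theorem ind_of_mem {τ : Box n} {q : Coord n} (h : q ∈ τ.coords) : τ.ind q = 1 := by
  simp [ind, h]

theorem ind_of_notMem {τ : Box n} {q : Coord n} (h : q ∉ τ.coords) : τ.ind q = 0 := by
  simp [ind, h]

end Box

/-- The box of the subtree `S` whose leaves are numbered `s, s+1, …`. -/
def boxOf (S : PTree (Fin n)) (s : ℕ) : Box n := ⟨s, S.leaves, balanced S⟩

theorem mem_balanced {S : PTree (Fin n)} {c : Fin n} : c ∈ balanced S ↔ S.pebbleDefault c = 0 := by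
  simp [balanced]

theorem notMem_balanced {S : PTree (Fin n)} (hS : S.IsPebbleTree) {c : Fin n} :
    c ∉ balanced S ↔ S.pebbleDefault c = 1 := by
  rw [mem_balanced]
  rcases PTree.pebbleDefault_eq hS c with h | h <;> simp [h]

mutual
/-- The boxes of the nodes of a tree. -/
def boxes : PTree (Fin n) → ℕ → List (Box n)
  | .leaf, _ => []
  | .node p cs, s => boxOf (.node p cs) s :: boxesList cs s
/-- The boxes of the nodes of a forest. -/
def boxesList : List (PTree (Fin n)) → ℕ → List (Box n)
  | [], _ => []
  | C :: cs, s => boxes C s ++ boxesList cs (s + C.leaves)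
end

/-- The boxes of the nodes of a tree distinct from its root. -/
def properBoxes : PTree (Fin n) → ℕ → List (Box n)
  | .leaf, _ => []
  | .node _ cs, s => boxesList cs s

theorem boxesList_append (cs ds : List (PTree (Fin n))) (s : ℕ) :
    boxesList (cs ++ ds) s = boxesList cs s ++ boxesList ds (s + (cs.map PTree.leaves).sum) := by
  induction cs generalizing s with
  | nil => simp [boxesList]
  | cons C cs ih => simp [boxesList, ih, add_assoc]

theorem boxesList_split (pre post : List (PTree (Fin n))) (C : PTree (Fin n)) (s : ℕ) :
    boxesList (pre ++ C :: post) s = boxesList pre s ++ (boxes C (s + (pre.map PTree.leaves).sum) ++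
      boxesList post (s + (pre.map PTree.leaves).sum + C.leaves)) := by
  rw [boxesList_append, boxesList]

theorem exists_of_mem_boxesList {cs : List (PTree (Fin n))} {s : ℕ} {τ : Box n}
    (h : τ ∈ boxesList cs s) : ∃ pre C post, cs = pre ++ C :: post ∧
      τ ∈ boxes C (s + (pre.map PTree.leaves).sum) := by
  induction cs generalizing s with
  | nil => simp [boxesList] at h
  | cons C cs ih =>
    rw [boxesList, List.mem_append] at h
    rcases h with h | h
    · exact ⟨[], C, cs, rfl, by simpa using h⟩
    · obtain ⟨pre, D, post, rfl, hD⟩ := ih h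
      exact ⟨C :: pre, D, post, rfl, by simpa [add_assoc] using hD⟩

/-- The boxes of a tree are the boxes of its subtrees which are not leaves. -/
theorem mem_boxes_iff {T : PTree (Fin n)} {s : ℕ} {τ : Box n} :
    τ ∈ boxes T s ↔ ∃ S t, T.IsSubtreeAt s S t ∧ S ≠ .leaf ∧ τ = boxOf S t := by
  constructor
  · intro h
    induction T using PTree.induction_children generalizing s with
    | leaf => simp [boxes] at h
    | node p cs ih =>
      rw [boxes, List.mem_cons] at h
      rcases h with rfl | h
      · exact ⟨_, _, .refl _ _, by simp, rfl⟩
      · obtain ⟨pre, C, post, rfl, hC⟩ := exists_of_mem_boxesList h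
        obtain ⟨S, t, hS, hl, rfl⟩ := ih C (by simp) hC
        exact ⟨S, t, .child hS, hl, rfl⟩
  · rintro ⟨S, t, hS, hl, rfl⟩
    induction hS with
    | refl T s =>
      cases T with
      | leaf => exact absurd rfl hl
      | node p cs => simp [boxes]
    | child h ih =>
      rw [boxes, boxesList_split]
      simp [ih hl]

/-! ### Contractions -/

end PebbleTree

namespace PTree

variable {κ : Type} {T T' : PTree κ}

theorem Contracts.leaves_eq (h : Contracts T T') : T'.leaves = T.leaves := by
  induction h with
  | here p q pre cs post => simp [leaves]
  | inside p pre post h ih => simp [leaves, ih]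

theorem Contracts.pebbles_eq (h : Contracts T T') (c : κ) : T'.pebbles c = T.pebbles c := by
  induction h with
  | here p q pre cs post => simp [pebbles]; ring
  | inside p pre post h ih => simp [pebbles, ih]

theorem Contracts.pebbleDefault_eq (h : Contracts T T') (c : κ) :
    T'.pebbleDefault c = T.pebbleDefault c := by
  rw [pebbleDefault, pebbleDefault, h.leaves_eq, h.pebbles_eq]

theorem Contracts.isPebbleTree (h : Contracts T T') (hT : T.IsPebbleTree) : T'.IsPebbleTree := by
  induction h with
  | here p q pre cs post =>
    have hd := fun c => (Contracts.here p q pre cs post).pebbleDefault_eq c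
    rw [IsPebbleTree] at hT
    obtain ⟨-, h1, h2, h3⟩ := hT
    have hq := h3 (node q cs) (by simp)
    rw [IsPebbleTree] at hq
    rw [IsPebbleTree]
    refine ⟨by simp [hq.1], fun hl => ?_, fun c => by rw [hd]; exact h2 c, fun C hC => ?_⟩
    -- The list `cs` is nonempty, so if the merged node has a single child, then so had the
    -- contracted node, whose pebble the merged node inherits.
    · have := List.length_pos_of_ne_nil hq.1
      simp only [List.length_append] at hl
      obtain ⟨c, hc⟩ := hq.2.1 (by omega)
      exact ⟨c, by simp only [Pi.add_apply]; omega⟩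
    · simp only [List.mem_append] at hC
      rcases hC with (hC | hC) | hC
      · exact h3 C (by simp [hC])
      · exact hq.2.2.2 C hC
      · exact h3 C (by simp [hC])
  | @inside p pre post C C' h ih =>
    have hd := fun c => (Contracts.inside p pre post h).pebbleDefault_eq c
    rw [IsPebbleTree] at hT ⊢
    obtain ⟨-, h1, h2, h3⟩ := hT
    refine ⟨by simp, fun hl => h1 (by simpa using hl), fun c => by rw [hd]; exact h2 c,
      fun D hD => ?_⟩
    simp only [List.mem_append, List.mem_cons] at hD
    rcases hD with hD | rfl | hD
    · exact h3 D (by simp [hD])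
    · exact ih (h3 C (by simp))
    · exact h3 D (by simp [hD])

end PTree

namespace PebbleTree

variable {n : ℕ} {T T' : PTree (Fin n)}

theorem boxOf_eq_of_contracts (h : T.Contracts T') (s : ℕ) : boxOf T' s = boxOf T s := by
  simp [boxOf, balanced, h.leaves_eq, h.pebbleDefault_eq]

theorem boxes_eq_cons (hT : T ≠ .leaf) (s : ℕ) : boxes T s = boxOf T s :: properBoxes T s := by
  cases T with
  | leaf => exact absurd rfl hT
  | node p cs => rw [boxes, properBoxes]

/-- Contraction changes neither the leaf positions nor the defaults of the surviving nodes, so only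
the box of the contracted node is lost. -/
theorem properBoxes_here (p q : Fin n → ℕ) (pre cs post : List (PTree (Fin n))) (s : ℕ) :
    (properBoxes (.node p (pre ++ .node q cs :: post)) s).Perm
      (boxOf (.node q cs) (s + (pre.map PTree.leaves).sum) ::
        properBoxes (.node (p + q) (pre ++ cs ++ post)) s) := by
  rw [properBoxes, properBoxes, boxesList_split, boxes, boxesList_append, boxesList_append,
    List.append_assoc]
  simp [PTree.leaves, add_assoc, List.perm_middle]

theorem properBoxes_inside {p : Fin n → ℕ} {pre post : List (PTree (Fin n))}
    {C C' : PTree (Fin n)} {s : ℕ} {τ : Box n} (h : C.Contracts C')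
    (hτ : (properBoxes C (s + (pre.map PTree.leaves).sum)).Perm
      (τ :: properBoxes C' (s + (pre.map PTree.leaves).sum))) :
    (properBoxes (.node p (pre ++ C :: post)) s).Perm
      (τ :: properBoxes (.node p (pre ++ C' :: post)) s) := by
  have hC : C ≠ .leaf := by rintro rfl; cases h
  have hC' : C' ≠ .leaf := by rintro rfl; cases h
  rw [properBoxes, properBoxes, boxesList_split, boxesList_split, boxes_eq_cons hC,
    boxes_eq_cons hC', boxOf_eq_of_contracts h, h.leaves_eq]
  refine List.Perm.trans ?_ List.perm_middle
  refine List.Perm.append_left _ ?_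
  rw [← List.cons_append]
  refine List.Perm.append_right _ ?_
  exact (List.Perm.cons _ hτ).trans (List.Perm.swap _ _ _)

theorem exists_properBoxes_perm (h : T.Contracts T') (s : ℕ) :
    ∃ τ, (properBoxes T s).Perm (τ :: properBoxes T' s) := by
  induction h generalizing s with
  | here p q pre cs post => exact ⟨_, properBoxes_here p q pre cs post s⟩
  | inside p pre post h ih =>
    obtain ⟨τ, hτ⟩ := ih (s + (pre.map PTree.leaves).sum)
    exact ⟨τ, properBoxes_inside h hτ⟩

theorem exists_contracts {s : ℕ} {τ : Box n} (h : τ ∈ properBoxes T s) :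
    ∃ T', T.Contracts T' ∧ (properBoxes T s).Perm (τ :: properBoxes T' s) := by
  induction T using PTree.induction_children generalizing s with
  | leaf => simp [properBoxes] at h
  | node p cs ih =>
    rw [properBoxes] at h
    obtain ⟨pre, C, post, rfl, hC⟩ := exists_of_mem_boxesList h
    cases C with
    | leaf => simp [boxes] at hC
    | node q ds =>
      rw [boxes, List.mem_cons] at hC
      rcases hC with rfl | hC
      · exact ⟨_, .here p q pre ds post, properBoxes_here p q pre ds post s⟩
      · obtain ⟨C', hC', hp⟩ := ih (.node q ds) (by simp) hC
        exact ⟨_, .inside p pre post hC', properBoxes_inside hC' hp⟩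

theorem properBoxes_subset_of_contractions (h : Relation.ReflTransGen PTree.Contracts T T')
    (s : ℕ) : properBoxes T' s ⊆ properBoxes T s := by
  induction h with
  | refl => exact List.Subset.refl _
  | tail _ hc ih =>
    obtain ⟨τ, hτ⟩ := exists_properBoxes_perm hc s
    exact fun σ hσ => ih (hτ.mem_iff.2 (List.mem_cons_of_mem _ hσ))

/-- Contract, one at a time, the nodes whose boxes lie outside X. The induction is on the number of
boxes, so repeated boxes would be harmless. -/
theorem exists_contractions (T : PTree (Fin n)) (s : ℕ) (X : Set (Box n))
    (hX : ∀ τ ∈ X, τ ∈ properBoxes T s) :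
    ∃ T', Relation.ReflTransGen PTree.Contracts T T' ∧ ∀ τ, τ ∈ properBoxes T' s ↔ τ ∈ X := by
  induction hk : (properBoxes T s).length using Nat.strong_induction_on generalizing T with
  | _ k ih =>
    by_cases hall : ∀ τ ∈ properBoxes T s, τ ∈ X
    · exact ⟨T, .refl, fun τ => ⟨hall τ, hX τ⟩⟩
    · push Not at hall
      obtain ⟨τ, hτ, hτX⟩ := hall
      obtain ⟨T₁, hc, hp⟩ := exists_contracts hτ
      obtain ⟨T', hT', hmem⟩ := ih (properBoxes T₁ s).length
        (by rw [← hk, hp.length_eq]; simp) T₁ (fun σ hσ => by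
          rcases List.mem_cons.1 (hp.mem_iff.1 (hX σ hσ)) with rfl | h
          · exact absurd hσ hτX
          · exact h) rfl
      exact ⟨T', hT'.head hc, hmem⟩

theorem pebble_of_contractions (h : Relation.ReflTransGen PTree.Contracts T T')
    (hT : T.IsPebbleTree) : T'.IsPebbleTree ∧ T'.leaves = T.leaves ∧
      ∀ c, T'.pebbleDefault c = T.pebbleDefault c := by
  induction h with
  | refl => exact ⟨hT, rfl, fun _ => rfl⟩
  | tail _ hc ih =>
    exact ⟨hc.isPebbleTree ih.1, hc.leaves_eq.trans ih.2.1,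
      fun c => (hc.pebbleDefault_eq c).trans (ih.2.2 c)⟩

end PebbleTree

/-! ### Uniqueness of the decomposition -/

namespace PebbleTree

variable {n : ℕ}

/-- The linear combination of the characteristic vectors of a list of boxes with weights `w`. -/
noncomputable def wsum (l : List (Box n)) (w : Box n → ℝ) : Coord n → ℝ :=
  (l.map fun τ => w τ • τ.ind).sum

theorem wsum_nil (w : Box n → ℝ) : wsum [] w = 0 := rfl

theorem wsum_cons (τ : Box n) (l : List (Box n)) (w : Box n → ℝ) :
    wsum (τ :: l) w = w τ • τ.ind + wsum l w := by
  simp [wsum]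

theorem wsum_append (l l' : List (Box n)) (w : Box n → ℝ) :
    wsum (l ++ l') w = wsum l w + wsum l' w := by
  simp [wsum]

theorem wsum_nonneg {l : List (Box n)} {w : Box n → ℝ} (hw : ∀ τ ∈ l, 0 < w τ) (q : Coord n) :
    0 ≤ wsum l w q := by
  induction l with
  | nil => simp [wsum_nil]
  | cons τ l ih =>
    rw [wsum_cons]
    exact add_nonneg (mul_nonneg (hw τ (by simp)).le (τ.ind_nonneg q))
      (ih fun σ hσ => hw σ (by simp [hσ]))

theorem wsum_eq_zero {l : List (Box n)} (w : Box n → ℝ) {q : Coord n}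
    (h : ∀ τ ∈ l, q ∉ τ.coords) : wsum l w q = 0 := by
  induction l with
  | nil => simp [wsum_nil]
  | cons τ l ih =>
    rw [wsum_cons, Pi.add_apply, Pi.smul_apply, Box.ind_of_notMem (h τ (by simp)),
      ih fun σ hσ => h σ (by simp [hσ])]
    simp

theorem wsum_pos {l : List (Box n)} {w : Box n → ℝ} (hw : ∀ τ ∈ l, 0 < w τ) {τ : Box n}
    (hτ : τ ∈ l) {q : Coord n} (hq : q ∈ τ.coords) : 0 < wsum l w q := by
  obtain ⟨l₁, l₂, rfl⟩ := List.append_of_mem hτ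
  rw [wsum_append, wsum_cons, Pi.add_apply, Pi.add_apply, Pi.smul_apply, Box.ind_of_mem hq]
  have h₁ := wsum_nonneg (l := l₁) (w := w) (fun σ hσ => hw σ (by simp [hσ])) q
  have h₂ := wsum_nonneg (l := l₂) (w := w) (fun σ hσ => hw σ (by simp [hσ])) q
  have h₃ := hw τ hτ
  simp only [smul_eq_mul, mul_one]
  linarith

/-- The box of all colours on the leaves `s, …, s + m - 1`. -/
def fullBox (n s m : ℕ) : Box n := ⟨s, m, Finset.univ⟩

theorem none_mem_fullBox {s m j : ℕ} :
    ((none, j) : Coord n) ∈ (fullBox n s m).coords ↔ s ≤ j ∧ j + 1 < s + m :=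
  Box.none_mem_coords

theorem some_mem_fullBox {s m j : ℕ} {c : Fin n} :
    ((some c, j) : Coord n) ∈ (fullBox n s m).coords ↔ s ≤ j ∧ j < s + m := by
  rw [Box.some_mem_coords]; simp [fullBox]

theorem bounds_of_mem_fullBox {s m : ℕ} {q : Coord n} (h : q ∈ (fullBox n s m).coords) :
    s ≤ q.2 ∧ q.2 < s + m := ⟨h.1, h.2.1⟩

theorem coords_subset_fullBox {τ : Box n} {s m : ℕ} (h : s ≤ τ.start)
    (h' : τ.start + τ.len ≤ s + m) : τ.coords ⊆ (fullBox n s m).coords := by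
  rintro ⟨_ | c, j⟩ hq
  · rw [Box.none_mem_coords] at hq
    rw [none_mem_fullBox]
    omega
  · rw [Box.some_mem_coords] at hq
    rw [some_mem_fullBox]
    omega

-- Supports and uncovered coordinates of combinations of boxes.

theorem range_of_mem_boxesList {cs : List (PTree (Fin n))}
    (ih : ∀ C ∈ cs, ∀ (s : ℕ) (τ : Box n), τ ∈ boxes C s →
      s ≤ τ.start ∧ τ.start + τ.len ≤ s + C.leaves) {s : ℕ} {τ : Box n} (h : τ ∈ boxesList cs s) :
    s ≤ τ.start ∧ τ.start + τ.len ≤ s + (cs.map PTree.leaves).sum := by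
  obtain ⟨pre, C, post, rfl, hC⟩ := exists_of_mem_boxesList h
  have := ih C (by simp) _ _ hC
  simp only [List.map_append, List.map_cons, List.sum_append, List.sum_cons]
  omega

theorem range_of_mem_boxes {T : PTree (Fin n)} {s : ℕ} {τ : Box n} (h : τ ∈ boxes T s) :
    s ≤ τ.start ∧ τ.start + τ.len ≤ s + T.leaves := by
  induction T using PTree.induction_children generalizing s τ with
  | leaf => simp [boxes] at h
  | node p cs ih =>
    rw [boxes, List.mem_cons] at h
    rcases h with rfl | h
    · exact ⟨le_rfl, le_rfl⟩
    · rw [PTree.leaves]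
      exact range_of_mem_boxesList (fun C hC s τ h => ih C hC h) h

theorem wsum_boxes_eq_zero {T : PTree (Fin n)} {s : ℕ} (w : Box n → ℝ) {q : Coord n}
    (h : q ∉ (fullBox n s T.leaves).coords) : wsum (boxes T s) w q = 0 :=
  wsum_eq_zero w fun _ hτ hq =>
    h (coords_subset_fullBox (range_of_mem_boxes hτ).1 (range_of_mem_boxes hτ).2 hq)

theorem wsum_boxesList_eq_zero {cs : List (PTree (Fin n))} {s : ℕ} (w : Box n → ℝ) {q : Coord n}
    (h : q ∉ (fullBox n s (cs.map PTree.leaves).sum).coords) : wsum (boxesList cs s) w q = 0 :=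
  wsum_eq_zero w fun _ hτ hq => h (by
    have := range_of_mem_boxesList (fun C _ s τ h => range_of_mem_boxes h) hτ
    exact coords_subset_fullBox this.1 this.2 hq)

theorem wsum_boxesList_split (pre post : List (PTree (Fin n))) (C : PTree (Fin n)) (s : ℕ)
    (w : Box n → ℝ) {q : Coord n}
    (hq : q ∈ (fullBox n (s + (pre.map PTree.leaves).sum) C.leaves).coords) :
    wsum (boxesList (pre ++ C :: post) s) w q =
      wsum (boxes C (s + (pre.map PTree.leaves).sum)) w q := by
  have hb := bounds_of_mem_fullBox hq
  rw [boxesList_split, wsum_append, wsum_append, Pi.add_apply, Pi.add_apply,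
    wsum_boxesList_eq_zero (cs := pre), wsum_boxesList_eq_zero (cs := post)]
  · simp
  · intro h
    have := bounds_of_mem_fullBox h
    omega
  · intro h
    have := bounds_of_mem_fullBox h
    omega

theorem wsum_boxesList_cons (cs : List (PTree (Fin n))) (C : PTree (Fin n)) (s : ℕ)
    (w : Box n → ℝ) {q : Coord n} (hq : q ∈ (fullBox n s C.leaves).coords) :
    wsum (boxesList (C :: cs) s) w q = wsum (boxes C s) w q := by
  simpa using wsum_boxesList_split [] cs C s w (q := q) (by simpa using hq)

/-- This is the gap just after the last leaf of C; no box of a single tree of the forest straddles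
it. -/
theorem wsum_boxesList_gap (cs : List (PTree (Fin n))) {C : PTree (Fin n)} (hC : 0 < C.leaves)
    (s : ℕ) (w : Box n → ℝ) : wsum (boxesList (C :: cs) s) w (none, s + C.leaves - 1) = 0 := by
  rw [boxesList, wsum_append, Pi.add_apply, wsum_boxes_eq_zero, wsum_boxesList_eq_zero, add_zero]
  · rw [none_mem_fullBox]; omega
  · rw [none_mem_fullBox]; omega

theorem exists_wsum_eq_zero_of_child {pre post : List (PTree (Fin n))} {C : PTree (Fin n)} {s : ℕ}
    {w : Box n → ℝ} {c : Fin n} (h : ∃ j, s + (pre.map PTree.leaves).sum ≤ j ∧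
      j < s + (pre.map PTree.leaves).sum + C.leaves ∧
      wsum (boxes C (s + (pre.map PTree.leaves).sum)) w (some c, j) = 0) :
    ∃ j, s ≤ j ∧ j < s + ((pre ++ C :: post).map PTree.leaves).sum ∧
      wsum (boxesList (pre ++ C :: post) s) w (some c, j) = 0 := by
  obtain ⟨j, h₁, h₂, h₃⟩ := h
  refine ⟨j, by omega, ?_, ?_⟩
  · simp only [List.map_append, List.map_cons, List.sum_append, List.sum_cons]
    omega
  · rw [wsum_boxesList_split _ _ _ _ _ (some_mem_fullBox.2 ⟨h₁, h₂⟩), h₃]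

theorem exists_child_unbalanced {p : Fin n → ℕ} {cs : List (PTree (Fin n))} {c : Fin n}
    (hc : 0 < (PTree.node p cs).pebbleDefault c + p c) : ∃ C ∈ cs, c ∉ balanced C := by
  by_contra! h
  rw [PTree.pebbleDefault_node, List.sum_eq_zero] at hc
  · omega
  · intro x hx
    obtain ⟨C, hC, rfl⟩ := List.mem_map.1 hx
    exact mem_balanced.1 (h C hC)

/-- A node unbalanced in c has a child unbalanced in c. Descending through such children ends at a
leaf all of whose ancestors in T are unbalanced in c, so no box covers it in colour c. -/
theorem exists_wsum_boxes_eq_zero {T : PTree (Fin n)} (hT : T.IsPebbleTree) {c : Fin n}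
    (hc : c ∉ balanced T) (s : ℕ) (w : Box n → ℝ) :
    ∃ j, s ≤ j ∧ j < s + T.leaves ∧ wsum (boxes T s) w (some c, j) = 0 := by
  induction T using PTree.induction_children generalizing s with
  | leaf => exact ⟨s, le_rfl, by simp [PTree.leaves], by simp [boxes, wsum_nil]⟩
  | node p cs ih =>
    obtain ⟨C, hC, hCc⟩ := exists_child_unbalanced (p := p) (c := c)
      (by rw [(notMem_balanced hT).1 hc]; omega)
    obtain ⟨pre, post, rfl⟩ := List.append_of_mem hC
    have hCp : C.IsPebbleTree := by rw [PTree.IsPebbleTree] at hT; exact hT.2.2.2 C hC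
    obtain ⟨j, h₁, h₂, h₃⟩ := exists_wsum_eq_zero_of_child (post := post) (s := s) (w := w)
      (ih C hC hCp hCc (s + (pre.map PTree.leaves).sum))
    refine ⟨j, h₁, by rw [PTree.leaves]; exact h₂, ?_⟩
    rw [boxes, wsum_cons, Pi.add_apply, Pi.smul_apply, Box.ind_of_notMem, h₃]
    · simp
    · rw [Box.some_mem_coords]
      exact fun h => hc h.1

theorem exists_wsum_boxesList_eq_zero {cs : List (PTree (Fin n))}
    (hcs : ∀ C ∈ cs, C.IsPebbleTree) {C : PTree (Fin n)} (hC : C ∈ cs) {c : Fin n}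
    (hc : c ∉ balanced C) (s : ℕ) (w : Box n → ℝ) :
    ∃ j, s ≤ j ∧ j < s + (cs.map PTree.leaves).sum ∧
      wsum (boxesList cs s) w (some c, j) = 0 := by
  obtain ⟨pre, post, rfl⟩ := List.append_of_mem hC
  exact exists_wsum_eq_zero_of_child
    (exists_wsum_boxes_eq_zero (hcs C hC) hc (s + (pre.map PTree.leaves).sum) w)

/-- The proper boxes of a tree do not cover its root box. -/
theorem exists_mem_coords_wsum_eq_zero {p : Fin n → ℕ} {cs : List (PTree (Fin n))}
    (hT : (PTree.node p cs).IsPebbleTree) (s : ℕ) (w : Box n → ℝ) :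
    ∃ q ∈ (boxOf (PTree.node p cs) s).coords, wsum (boxesList cs s) w q = 0 := by
  have hT' := hT
  rw [PTree.IsPebbleTree] at hT'
  obtain ⟨h₀, h₁, h₂, h₃⟩ := hT'
  match cs, h₀ with
  | [C], _ =>
    obtain ⟨c, hc⟩ := h₁ rfl
    have hd := PTree.pebbleDefault_node p [C] c
    simp only [List.map_cons, List.map_nil, List.sum_cons, List.sum_nil, add_zero] at hd
    have hC := h₃ C (by simp)
    -- The two defaults lie in {0, 1} and differ by `p c`, which is at least 1.
    have hval : (PTree.node p [C]).pebbleDefault c = 0 ∧ C.pebbleDefault c = 1 := by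
      rcases h₂ c with h | h <;> rcases PTree.pebbleDefault_eq hC c with h' | h' <;> omega
    obtain ⟨j, hj₁, hj₂, hj₃⟩ := exists_wsum_boxesList_eq_zero h₃ (C := C) (by simp)
      ((notMem_balanced hC).2 hval.2) s w
    exact ⟨(some c, j), Box.some_mem_coords.2 ⟨mem_balanced.2 hval.1, hj₁,
      by simpa [boxOf, PTree.leaves] using hj₂⟩, hj₃⟩
  | C :: D :: cs, _ =>
    have hC := PTree.leaves_pos (h₃ C (by simp))
    have hD := PTree.leaves_pos (h₃ D (by simp))
    refine ⟨(none, s + C.leaves - 1), ?_, wsum_boxesList_gap _ hC s w⟩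
    rw [Box.none_mem_coords]
    simp only [boxOf, PTree.leaves, List.map_cons, List.sum_cons]
    omega

-- Reading a tree off a positive combination of its boxes.

theorem wsum_boxes_pos {T : PTree (Fin n)} {s : ℕ} {w : Box n → ℝ}
    (hw : ∀ τ ∈ boxes T s, 0 < w τ) {q : Coord n} (hT : T ≠ .leaf) (hq : q ∈ (boxOf T s).coords) :
    0 < wsum (boxes T s) w q :=
  wsum_pos hw (by rw [boxes_eq_cons hT]; simp) hq

theorem wsum_boxes_gap_pos {T : PTree (Fin n)} {s : ℕ} {w : Box n → ℝ}
    (hw : ∀ τ ∈ boxes T s, 0 < w τ) {j : ℕ} (h : s ≤ j) (h' : j + 1 < s + T.leaves) :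
    0 < wsum (boxes T s) w (none, j) :=
  wsum_boxes_pos hw (by rintro rfl; simp only [PTree.leaves] at h'; omega)
    (Box.none_mem_coords.2 ⟨h, h'⟩)

theorem mem_balanced_iff_wsum_pos {T : PTree (Fin n)} (hT : T.IsPebbleTree) {s : ℕ} {w : Box n → ℝ}
    (hw : ∀ τ ∈ boxes T s, 0 < w τ) {c : Fin n} :
    c ∈ balanced T ↔ ∀ j, s ≤ j → j < s + T.leaves → 0 < wsum (boxes T s) w (some c, j) := by
  constructor
  · intro hc j h h'
    refine wsum_boxes_pos hw ?_ (Box.some_mem_coords.2 ⟨hc, h, h'⟩)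
    rintro rfl
    rw [mem_balanced] at hc
    simp [PTree.pebbleDefault, PTree.leaves, PTree.pebbles] at hc
  · intro h
    by_contra hc
    obtain ⟨j, h₁, h₂, h₃⟩ := exists_wsum_boxes_eq_zero hT hc s w
    exact (h j h₁ h₂).ne' h₃

/-- The decomposition of a vector along a given tree shape determines the tree. -/
def DeterminedBy (C : PTree (Fin n)) : Prop :=
  ∀ (C' : PTree (Fin n)) (s : ℕ) (w w' : Box n → ℝ), C.IsPebbleTree → C'.IsPebbleTree →
    (∀ τ ∈ boxes C s, 0 < w τ) → (∀ τ ∈ boxes C' s, 0 < w' τ) → C.leaves = C'.leaves →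
    balanced C = balanced C' → wsum (boxes C s) w = wsum (boxes C' s) w' →
    C = C' ∧ ∀ τ ∈ boxes C s, w τ = w' τ

/-- The root box of the first tree makes its inner gaps positive, while the gap after it vanishes.
The vector therefore gives the length of the first tree, then its restriction to that tree, then its
balanced colours by positivity; cancel the tree and continue. -/
theorem eq_of_wsum_boxesList {cs cs' : List (PTree (Fin n))} (ih : ∀ C ∈ cs, DeterminedBy C)
    (hcs : ∀ C ∈ cs, C.IsPebbleTree) (hcs' : ∀ C ∈ cs', C.IsPebbleTree) {s : ℕ}
    {w w' : Box n → ℝ} (hw : ∀ τ ∈ boxesList cs s, 0 < w τ) (hw' : ∀ τ ∈ boxesList cs' s, 0 < w' τ)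
    (hl : (cs.map PTree.leaves).sum = (cs'.map PTree.leaves).sum)
    (h : wsum (boxesList cs s) w = wsum (boxesList cs' s) w') :
    cs = cs' ∧ ∀ τ ∈ boxesList cs s, w τ = w' τ := by
  induction cs generalizing cs' s with
  | nil =>
    cases cs' with
    | nil => simp [boxesList]
    | cons D ds =>
      have := PTree.leaves_pos (hcs' D (by simp))
      simp only [List.map_nil, List.sum_nil, List.map_cons, List.sum_cons] at hl
      omega
  | cons C cs ihl =>
    have hC := PTree.leaves_pos (hcs C (by simp))
    cases cs' with
    | nil =>
      simp only [List.map_nil, List.sum_nil, List.map_cons, List.sum_cons] at hl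
      omega
    | cons D ds =>
      have hD := PTree.leaves_pos (hcs' D (by simp))
      have hwC : ∀ τ ∈ boxes C s, 0 < w τ := fun τ hτ => hw τ (by simp [boxesList, hτ])
      have hwD : ∀ τ ∈ boxes D s, 0 < w' τ := fun τ hτ => hw' τ (by simp [boxesList, hτ])
      have hCD : C.leaves = D.leaves := by
        rcases lt_trichotomy C.leaves D.leaves with hlt | heq | hlt
        · have h₁ := wsum_boxes_gap_pos hwD (j := s + C.leaves - 1) (by omega) (by omega)
          rw [← wsum_boxesList_cons ds D s w' (none_mem_fullBox.2 ⟨by omega, by omega⟩), ← h,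
            wsum_boxesList_gap cs hC] at h₁
          exact absurd h₁ (lt_irrefl _)
        · exact heq
        · have h₁ := wsum_boxes_gap_pos hwC (j := s + D.leaves - 1) (by omega) (by omega)
          rw [← wsum_boxesList_cons cs C s w (none_mem_fullBox.2 ⟨by omega, by omega⟩), h,
            wsum_boxesList_gap ds hD] at h₁
          exact absurd h₁ (lt_irrefl _)
      have hCDw : wsum (boxes C s) w = wsum (boxes D s) w' := by
        funext q
        by_cases hq : q ∈ (fullBox n s C.leaves).coords
        · rw [← wsum_boxesList_cons cs C s w hq, h, wsum_boxesList_cons ds D s w' (hCD ▸ hq)]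
        · rw [wsum_boxes_eq_zero w hq, wsum_boxes_eq_zero w' (hCD ▸ hq)]
      have hbal : balanced C = balanced D := by
        ext c
        rw [mem_balanced_iff_wsum_pos (hcs C (by simp)) hwC,
          mem_balanced_iff_wsum_pos (hcs' D (by simp)) hwD, hCDw, hCD]
      obtain ⟨rfl, hww⟩ := ih C (by simp) D s w w' (hcs C (by simp)) (hcs' D (by simp)) hwC hwD
        hCD hbal hCDw
      rw [boxesList, boxesList, wsum_append, wsum_append, hCDw, add_right_inj] at h
      obtain ⟨rfl, hww'⟩ := ihl (fun E hE => ih E (by simp [hE])) (fun E hE => hcs E (by simp [hE]))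
        (fun E hE => hcs' E (by simp [hE])) (fun τ hτ => hw τ (by simp [boxesList, hτ]))
        (fun τ hτ => hw' τ (by simp [boxesList, hτ])) (by simpa using hl) h
      refine ⟨rfl, fun τ hτ => ?_⟩
      rw [boxesList, List.mem_append] at hτ
      exact hτ.elim (hww τ) (hww' τ)

/-- The pebbles of a node are the defaults of its children minus its own default. -/
theorem node_eq_node {p p' : Fin n → ℕ} {cs : List (PTree (Fin n))}
    (hT : (PTree.node p cs).IsPebbleTree) (hT' : (PTree.node p' cs).IsPebbleTree)
    (h : balanced (PTree.node p cs) = balanced (PTree.node p' cs)) : p = p' := by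
  funext c
  have hd : (PTree.node p cs).pebbleDefault c = (PTree.node p' cs).pebbleDefault c := by
    have hc : c ∈ balanced (PTree.node p cs) ↔ c ∈ balanced (PTree.node p' cs) := by rw [h]
    rw [mem_balanced, mem_balanced] at hc
    rcases PTree.pebbleDefault_eq hT c with h₁ | h₁ <;>
      rcases PTree.pebbleDefault_eq hT' c with h₂ | h₂ <;> omega
  rw [PTree.pebbleDefault_node, PTree.pebbleDefault_node] at hd
  omega

/-- A node has an uncovered coordinate in its box, whereas a box with one leaf and no colour has no
coordinates. The position and weights fed to that lemma are arbitrary. -/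
theorem leaf_eq_of_balanced {T : PTree (Fin n)} (hT : T.IsPebbleTree) (hl : T.leaves = 1)
    (hb : balanced T = ∅) : T = .leaf := by
  cases T with
  | leaf => rfl
  | node p cs =>
    obtain ⟨⟨_ | c, j⟩, hq, -⟩ := exists_mem_coords_wsum_eq_zero hT 0 0
    · rw [Box.none_mem_coords] at hq
      simp only [boxOf, hl] at hq
      omega
    · rw [Box.some_mem_coords] at hq
      simp [boxOf, hb] at hq

theorem balanced_leaf : balanced (.leaf : PTree (Fin n)) = ∅ := by
  ext c; simp [mem_balanced, PTree.pebbleDefault, PTree.leaves, PTree.pebbles]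

theorem determinedBy (C : PTree (Fin n)) : DeterminedBy C := by
  induction C using PTree.induction_children with
  | leaf =>
    intro C' s w w' _ hC' _ _ hl hb _
    refine ⟨(leaf_eq_of_balanced hC' ?_ ?_).symm, by simp [boxes]⟩
    · rw [← hl, PTree.leaves]
    · rw [← hb, balanced_leaf]
  | node p cs ih =>
    intro C' s w w' hC hC' hw hw' hl hb h
    cases C' with
    | leaf =>
      have := leaf_eq_of_balanced hC (by rw [hl, PTree.leaves]) (by rw [hb, balanced_leaf])
      cases this
    | node p' cs' =>
      have hbox : boxOf (.node p cs) s = boxOf (.node p' cs') s := by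
        rw [boxOf, boxOf, hl, hb]
      have hwl : ∀ τ ∈ boxesList cs s, 0 < w τ := fun τ hτ => hw τ (by simp [boxes, hτ])
      have hwl' : ∀ τ ∈ boxesList cs' s, 0 < w' τ := fun τ hτ => hw' τ (by simp [boxes, hτ])
      rw [boxes, boxes, wsum_cons, wsum_cons, ← hbox] at h
      -- At a coordinate of the common root box left uncovered by the children on one side, that
      -- side equals its root weight and the other is at least its own; the two choices of side give
      -- both inequalities.
      have hroot : w (boxOf (.node p cs) s) = w' (boxOf (.node p cs) s) := by
        obtain ⟨q, hq, hq0⟩ := exists_mem_coords_wsum_eq_zero hC s w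
        obtain ⟨q', hq', hq0'⟩ := exists_mem_coords_wsum_eq_zero hC' s w'
        rw [← hbox] at hq'
        have e := congrFun h q
        have e' := congrFun h q'
        simp only [Pi.add_apply, Pi.smul_apply, smul_eq_mul, Box.ind_of_mem hq, hq0] at e
        simp only [Pi.add_apply, Pi.smul_apply, smul_eq_mul, Box.ind_of_mem hq', hq0'] at e'
        have := wsum_nonneg hwl q'
        have := wsum_nonneg hwl' q
        linarith
      rw [hroot, add_right_inj] at h
      have hP := hC
      have hP' := hC'
      rw [PTree.IsPebbleTree] at hP hP'
      obtain ⟨rfl, hww⟩ := eq_of_wsum_boxesList ih hP.2.2.2 hP'.2.2.2 hwl hwl'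
        (by simpa [PTree.leaves] using hl) h
      obtain rfl := node_eq_node hC hC' hb
      refine ⟨rfl, fun τ hτ => ?_⟩
      rw [boxes, List.mem_cons] at hτ
      rcases hτ with rfl | hτ
      · exact hroot
      · exact hww τ hτ

end PebbleTree

/-! ### Existence of the decomposition -/

namespace PebbleTree

variable {n : ℕ}

theorem finite_coords (τ : Box n) : τ.coords.Finite := by
  refine ((Set.finite_univ (α := Option (Fin n))).prod
    (Set.finite_Ico τ.start (τ.start + τ.len))).subset fun q hq => ?_
  exact ⟨trivial, hq.1, hq.2.1⟩

/-- The cone generated by the characteristic vectors of a list of boxes. -/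
noncomputable def boxCone (l : List (Box n)) : PointedCone ℝ (Coord n → ℝ) :=
  PointedCone.hull ℝ (Box.ind '' {τ | τ ∈ l})

theorem boxCone_mono {l l' : List (Box n)} (h : l ⊆ l') : boxCone l ≤ boxCone l' :=
  Submodule.span_mono (Set.image_mono h)

/-- A nonnegative vector supported on the leaves `s, …, s + m - 1`. -/
structure SupportedOn (s m : ℕ) (X : Coord n → ℝ) : Prop where
  nonneg : ∀ q, 0 ≤ X q
  support : Function.support X ⊆ (fullBox n s m).coords

theorem SupportedOn.finite {s m : ℕ} {X : Coord n → ℝ} (h : SupportedOn s m X) :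
    (Function.support X).Finite :=
  (finite_coords _).subset h.support

theorem SupportedOn.eq_zero {s m : ℕ} {X : Coord n → ℝ} (h : SupportedOn s m X) {q : Coord n}
    (hq : q ∉ (fullBox n s m).coords) : X q = 0 := by
  by_contra h0
  exact hq (h.support h0)

theorem SupportedOn.indicator {s m : ℕ} {X : Coord n → ℝ} (h : SupportedOn s m X) (s' m' : ℕ) :
    SupportedOn s' m' ((fullBox n s' m').coords.indicator X) where
  nonneg := Set.indicator_nonneg fun q _ => h.nonneg q
  support := Set.support_indicator_subset

/-- The degenerate case, realized by a single leaf: no gap and no colour in the box, and the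
hypothesis on the missing colours kills X at the only leaf. -/
theorem SupportedOn.eq_zero_of_coords_eq_empty {s m : ℕ} {X : Coord n → ℝ}
    (hX : SupportedOn s m X) (hm : 0 < m) {B : Finset (Fin n)}
    (hemp : (⟨s, m, B⟩ : Box n).coords = ∅)
    (hB : ∀ c ∉ B, ∃ j, s ≤ j ∧ j < s + m ∧ X (some c, j) = 0) : m = 1 ∧ X = 0 ∧ B = ∅ := by
  have hm1 : m = 1 := by
    by_contra h
    have : ((none, s) : Coord n) ∈ (⟨s, m, B⟩ : Box n).coords :=
      Box.none_mem_coords.2 ⟨le_rfl, by simp only; omega⟩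
    simp [hemp] at this
  have hBe : ∀ c, c ∉ B := fun c hc => by
    have : ((some c, s) : Coord n) ∈ (⟨s, m, B⟩ : Box n).coords :=
      Box.some_mem_coords.2 ⟨hc, le_rfl, by simp only; omega⟩
    simp [hemp] at this
  refine ⟨hm1, ?_, Finset.eq_empty_of_forall_notMem hBe⟩
  funext q
  by_cases hq : q ∈ (fullBox n s m).coords
  · obtain ⟨_ | c, j⟩ := q
    · rw [none_mem_fullBox] at hq
      omega
    · rw [some_mem_fullBox] at hq
      obtain ⟨i, h₁, h₂, h₃⟩ := hB c (hBe c)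
      obtain rfl : i = j := by omega
      exact h₃
  · exact hX.eq_zero hq

/-- The vector `X` is decomposed by a forest of pebble trees whose shape is compatible with the
zeros of `X`. -/
def ForestDecomposition (s m : ℕ) (X : Coord n → ℝ) : Prop :=
  ∃ cs : List (PTree (Fin n)), cs ≠ [] ∧ (∀ C ∈ cs, C.IsPebbleTree) ∧
    (cs.map PTree.leaves).sum = m ∧ X ∈ boxCone (boxesList cs s) ∧
    (∀ c j, s ≤ j → j < s + m → X (some c, j) = 0 → ∃ C ∈ cs, c ∉ balanced C) ∧
    (cs.length = 1 → ∀ j, s ≤ j → j + 1 < s + m → 0 < X (none, j))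

/-- The vector `X` is decomposed by a pebble tree whose root is balanced for the colours `B`. -/
theorem ForestDecomposition.exists_root {s m : ℕ} {X : Coord n → ℝ}
    (h : ForestDecomposition s m X) {B : Finset (Fin n)}
    (hB : ∃ q ∈ (⟨s, m, B⟩ : Box n).coords, X q = 0)
    (hB' : ∀ c ∉ B, ∃ j, s ≤ j ∧ j < s + m ∧ X (some c, j) = 0) :
    ∃ p cs, (PTree.node p cs).IsPebbleTree ∧ (PTree.node p cs).leaves = m ∧
      balanced (PTree.node p cs) = B ∧ X ∈ boxCone (boxesList cs s) := by
  obtain ⟨cs, hne, hcs, hm, hX, hz, hl⟩ := h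
  have hnn : ∀ c : Fin n, ∀ x ∈ cs.map (PTree.pebbleDefault c), (0 : ℤ) ≤ x := by
    intro c x hx
    obtain ⟨C, hC, rfl⟩ := List.mem_map.1 hx
    rcases PTree.pebbleDefault_eq (hcs C hC) c with h | h <;> omega
  have hpos : ∀ c j, s ≤ j → j < s + m → X (some c, j) = 0 →
      1 ≤ (cs.map (PTree.pebbleDefault c)).sum := by
    intro c j h₁ h₂ h₃
    obtain ⟨C, hC, hc⟩ := hz c j h₁ h₂ h₃
    rw [← (notMem_balanced (hcs C hC)).1 hc]
    exact List.single_le_sum (hnn c) _ (List.mem_map_of_mem hC)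
  -- The pebble count forced by the prescribed default of the root. The truncation `toNat` is
  -- harmless: the sum is nonnegative, and at least 1 for colours outside B.
  let p : Fin n → ℕ := fun c =>
    ((cs.map (PTree.pebbleDefault c)).sum - if c ∈ B then 0 else 1).toNat
  have hd : ∀ c, (PTree.node p cs).pebbleDefault c = if c ∈ B then 0 else 1 := by
    intro c
    have h0 := List.sum_nonneg (hnn c)
    rw [PTree.pebbleDefault_node]
    simp only [p]
    split_ifs with hc
    · omega
    · obtain ⟨j, h₁, h₂, h₃⟩ := hB' c hc
      have := hpos c j h₁ h₂ h₃
      omega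
  refine ⟨p, cs, ?_, by rw [PTree.leaves, hm], ?_, hX⟩
  · rw [PTree.IsPebbleTree]
    refine ⟨hne, fun h1 => ?_, fun c => ?_, hcs⟩
    -- With a single child all gaps are positive, so the zero in the root box occurs at a colour of
    -- B; some child is unbalanced there, which forces a pebble.
    · obtain ⟨⟨_ | c, j⟩, hq, hq0⟩ := hB
      · rw [Box.none_mem_coords] at hq
        exact absurd hq0 (hl h1 j hq.1 hq.2).ne'
      · rw [Box.some_mem_coords] at hq
        have hq1 : c ∈ B := hq.1
        have := hpos c j hq.2.1 hq.2.2 hq0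
        refine ⟨c, ?_⟩
        simp only [p, if_pos hq1]
        omega
    · rw [hd]
      split_ifs <;> simp
  · ext c
    rw [mem_balanced, hd]
    split_ifs with hc <;> simp [hc]

/-- Without a vanishing gap, X must come from one tree, whose root is balanced in the colours where
X is positive at every leaf. Subtracting the minimum of X over this root box kills a coordinate of
the support; the rest decomposes as a forest to be put under the root. -/
theorem exists_tree {s m : ℕ} (hm : 0 < m) {X : Coord n → ℝ} (hX : SupportedOn s m X)
    (hgap : ∀ j, s ≤ j → j + 1 < s + m → 0 < X (none, j))
    (ih : ∀ Y : Coord n → ℝ, SupportedOn s m Y →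
      (Function.support Y).ncard < (Function.support X).ncard → ForestDecomposition s m Y) :
    ∃ C : PTree (Fin n), C.IsPebbleTree ∧ C.leaves = m ∧ X ∈ boxCone (boxes C s) ∧
      ∀ c ∈ balanced C, ∀ j, s ≤ j → j < s + m → 0 < X (some c, j) := by
  classical
  set B : Finset (Fin n) := Finset.univ.filter fun c => ∀ j, s ≤ j → j < s + m → 0 < X (some c, j)
    with hB
  have hmemB : ∀ c, c ∈ B ↔ ∀ j, s ≤ j → j < s + m → 0 < X (some c, j) := by simp [hB]
  have hnotB : ∀ c, c ∉ B → ∃ j, s ≤ j ∧ j < s + m ∧ X (some c, j) = 0 := by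
    intro c hc
    rw [hmemB] at hc
    push Not at hc
    obtain ⟨j, h₁, h₂, h₃⟩ := hc
    exact ⟨j, h₁, h₂, le_antisymm h₃ (hX.nonneg _)⟩
  rcases (⟨s, m, B⟩ : Box n).coords.eq_empty_or_nonempty with hemp | hne
  · obtain ⟨rfl, rfl, -⟩ := hX.eq_zero_of_coords_eq_empty hm hemp hnotB
    exact ⟨.leaf, by simp [PTree.IsPebbleTree], by rw [PTree.leaves], zero_mem _,
      by simp [balanced_leaf]⟩
  · obtain ⟨q₀, hq₀, hmin⟩ := Set.exists_min_image _ X (finite_coords _) hne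
    have hpos : 0 < X q₀ := by
      obtain ⟨_ | c, j⟩ := q₀
      · rw [Box.none_mem_coords] at hq₀
        exact hgap j hq₀.1 hq₀.2
      · rw [Box.some_mem_coords] at hq₀
        exact (hmemB c).1 hq₀.1 j hq₀.2.1 hq₀.2.2
    set τ : Box n := ⟨s, m, B⟩ with hτ
    set Y : Coord n → ℝ := X - X q₀ • τ.ind with hYdef
    have hin : ∀ q ∈ τ.coords, Y q = X q - X q₀ := fun q hq => by
      simp [hYdef, Box.ind_of_mem hq]
    have hout : ∀ q ∉ τ.coords, Y q = X q := fun q hq => by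
      simp [hYdef, Box.ind_of_notMem hq]
    have hsub : Function.support Y ⊆ Function.support X := by
      intro q hq hX0
      refine hq ?_
      by_cases hqτ : q ∈ τ.coords
      · have := hmin q hqτ
        linarith
      · rw [hout q hqτ, hX0]
    have hY : SupportedOn s m Y := by
      refine ⟨fun q => ?_, hsub.trans hX.support⟩
      by_cases hqτ : q ∈ τ.coords
      · rw [hin q hqτ]
        linarith [hmin q hqτ]
      · rw [hout q hqτ]
        exact hX.nonneg q
    have hq₀Y : Y q₀ = 0 := by rw [hin q₀ hq₀, sub_self]
    have hlt : (Function.support Y).ncard < (Function.support X).ncard :=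
      Set.ncard_lt_ncard (Set.ssubset_iff_exists.2 ⟨hsub, q₀, hpos.ne', by simpa using hq₀Y⟩)
        hX.finite
    obtain ⟨p, cs, hT, hl, hbal, hYc⟩ := (ih Y hY hlt).exists_root (B := B) ⟨q₀, hq₀, hq₀Y⟩
      fun c hc => by
        obtain ⟨j, h₁, h₂, h₃⟩ := hnotB c hc
        refine ⟨j, h₁, h₂, ?_⟩
        rw [hout, h₃]
        rw [Box.some_mem_coords]
        exact fun h => hc h.1
    refine ⟨.node p cs, hT, hl, ?_, ?_⟩
    · have hXY : X = X q₀ • τ.ind + Y := by rw [hYdef]; abel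
      have hroot : boxOf (.node p cs) s = τ := by rw [boxOf, hl, hbal]
      rw [hXY, boxes, hroot]
      refine add_mem ?_ (boxCone_mono (List.subset_cons_self _ _) hYc)
      exact Submodule.smul_mem _ (⟨X q₀, hpos.le⟩ : NNReal)
        (Submodule.subset_span (Set.mem_image_of_mem _ (by simp)))
    · intro c hc
      rw [hbal] at hc
      exact (hmemB c).1 hc

/-- Cut X at its first vanishing gap: the first piece is a tree by `exists_tree`, the rest has fewer
leaves. The cut need not shrink the support, hence an inner induction on the number of leaves with
support size at most k. -/
theorem forestDecomposition_of_lt {k : ℕ}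
    (ih : ∀ (s m : ℕ) (X : Coord n → ℝ), 0 < m → SupportedOn s m X →
      (Function.support X).ncard < k → ForestDecomposition s m X)
    (s m : ℕ) (X : Coord n → ℝ) (hm : 0 < m) (hX : SupportedOn s m X)
    (hk : (Function.support X).ncard ≤ k) : ForestDecomposition s m X := by
  classical
  induction m using Nat.strong_induction_on generalizing s X with
  | _ m ihm =>
    by_cases hgap : ∀ j, s ≤ j → j + 1 < s + m → 0 < X (none, j)
    · obtain ⟨C, hC, hl, hXC, hbal⟩ := exists_tree hm hX hgap
        fun Y hY hlt => ih s m Y hm hY (by omega)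
      refine ⟨[C], by simp, by simpa using hC, by simpa using hl, by simpa [boxesList] using hXC,
        fun c j h₁ h₂ h₃ => ⟨C, by simp, fun hc => ?_⟩, fun _ => hgap⟩
      exact absurd h₃ (hbal c hc j h₁ h₂).ne'
    · have hex : ∃ j, s ≤ j ∧ j + 1 < s + m ∧ X (none, j) = 0 := by
        push Not at hgap
        obtain ⟨j, h₁, h₂, h₃⟩ := hgap
        exact ⟨j, h₁, h₂, le_antisymm h₃ (hX.nonneg _)⟩
      obtain ⟨h₁, h₂, h₃⟩ := Nat.find_spec hex
      have hfirst : ∀ j, s ≤ j → j < Nat.find hex → 0 < X (none, j) := fun j hj hj' =>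
        (hX.nonneg _).lt_of_ne fun h0 => Nat.find_min hex hj' ⟨hj, by omega, h0.symm⟩
      -- The gap j₀ follows the leaf j₀, so the first piece consists of the r leaves s, …, j₀.
      obtain ⟨r, hr⟩ : ∃ r, Nat.find hex + 1 = s + r := ⟨Nat.find hex + 1 - s, by omega⟩
      generalize Nat.find hex = j₀ at h₁ h₂ h₃ hfirst hr
      set X₁ := (fullBox n s r).coords.indicator X with hX₁
      set X₂ := (fullBox n (s + r) (m - r)).coords.indicator X with hX₂
      have hle : ∀ A : Set (Coord n), (Function.support (A.indicator X)).ncard ≤ k := fun A => by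
        refine le_trans (Set.ncard_le_ncard ?_ hX.finite) hk
        rw [Set.support_indicator]
        exact Set.inter_subset_right
      have hs₁ : SupportedOn s r X₁ := hX.indicator s r
      have hs₂ : SupportedOn (s + r) (m - r) X₂ := hX.indicator _ _
      obtain ⟨C, hC, hl, hXC, hbal⟩ := exists_tree (by omega) hs₁
        (fun j hj hj' => by
          rw [hX₁, Set.indicator_of_mem (none_mem_fullBox.2 ⟨hj, hj'⟩)]
          exact hfirst j hj (by omega))
        fun Y hY hlt => ih s r Y (by omega) hY (hlt.trans_le (hle _))
      obtain ⟨cs, hne, hcs, hm', hXcs, hz, -⟩ := ihm (m - r) (by omega) (s + r) X₂ (by omega) hs₂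
        (hle _)
      refine ⟨C :: cs, by simp, ?_, ?_, ?_, ?_, ?_⟩
      · rintro D hD
        rcases List.mem_cons.1 hD with rfl | hD
        · exact hC
        · exact hcs D hD
      · rw [List.map_cons, List.sum_cons, hl, hm']; omega
      · have hsum : X = X₁ + X₂ := by
          funext q
          rw [Pi.add_apply, hX₁, hX₂, Set.indicator_apply, Set.indicator_apply]
          obtain ⟨_ | c, j⟩ := q
          · by_cases hq : ((none, j) : Coord n) ∈ (fullBox n s m).coords
            · simp only [none_mem_fullBox] at hq ⊢
              rcases lt_trichotomy j j₀ with hj | rfl | hj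
              · rw [if_pos (by omega), if_neg (by omega), add_zero]
              · rw [if_neg (by omega), if_neg (by omega), h₃, add_zero]
              · rw [if_neg (by omega), if_pos (by omega), zero_add]
            · rw [hX.eq_zero hq]; simp
          · by_cases hq : ((some c, j) : Coord n) ∈ (fullBox n s m).coords
            · simp only [some_mem_fullBox] at hq ⊢
              rcases lt_or_ge j (s + r) with hj | hj
              · rw [if_pos (by omega), if_neg (by omega), add_zero]
              · rw [if_neg (by omega), if_pos (by omega), zero_add]
            · rw [hX.eq_zero hq]; simp
        rw [hsum, boxesList, hl]
        exact add_mem (boxCone_mono (List.subset_append_left _ _) hXC)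
          (boxCone_mono (List.subset_append_right _ _) hXcs)
      · intro c j hj hj' h0
        rcases lt_or_ge j (s + r) with hjr | hjr
        · refine ⟨C, by simp, fun hc => ?_⟩
          have := hbal c hc j hj hjr
          rw [hX₁, Set.indicator_of_mem (some_mem_fullBox.2 ⟨hj, hjr⟩), h0] at this
          exact lt_irrefl _ this
        · obtain ⟨D, hD, hDc⟩ := hz c j hjr (by omega) (by
            rw [hX₂, Set.indicator_of_mem (some_mem_fullBox.2 ⟨hjr, by omega⟩), h0])
          exact ⟨D, by simp [hD], hDc⟩
      · intro h1
        simp only [List.length_cons, Nat.add_eq_right, List.length_eq_zero_iff] at h1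
        exact absurd h1 hne

theorem forestDecomposition {s m : ℕ} {X : Coord n → ℝ} (hm : 0 < m) (hX : SupportedOn s m X) :
    ForestDecomposition s m X := by
  induction hk : (Function.support X).ncard using Nat.strong_induction_on generalizing s m X with
  | _ k ih =>
    exact forestDecomposition_of_lt (fun s m X hm hX hlt => ih _ hlt hm hX rfl) s m X hm hX hk.le

/-- The root colours are now prescribed, and the zeros of X make a root compatible with them while
its box receives no weight. -/
theorem exists_pebbleTree {s m : ℕ} {X : Coord n → ℝ} (hm : 0 < m) (hX : SupportedOn s m X)
    {B : Finset (Fin n)} (hB : (⟨s, m, B⟩ : Box n).coords.Nonempty →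
      ∃ q ∈ (⟨s, m, B⟩ : Box n).coords, X q = 0)
    (hB' : ∀ c ∉ B, ∃ j, s ≤ j ∧ j < s + m ∧ X (some c, j) = 0) :
    ∃ T : PTree (Fin n), T.IsPebbleTree ∧ T.leaves = m ∧ balanced T = B ∧
      X ∈ boxCone (properBoxes T s) := by
  rcases (⟨s, m, B⟩ : Box n).coords.eq_empty_or_nonempty with hemp | hne
  · obtain ⟨rfl, rfl, rfl⟩ := hX.eq_zero_of_coords_eq_empty hm hemp hB'
    exact ⟨.leaf, by simp [PTree.IsPebbleTree], by rw [PTree.leaves], balanced_leaf, zero_mem _⟩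
  · obtain ⟨p, cs, h₁, h₂, h₃, h₄⟩ := (forestDecomposition hm hX).exists_root (hB hne) hB'
    exact ⟨.node p cs, h₁, h₂, h₃, h₄⟩

end PebbleTree

/-! ### From boxes to rays -/

namespace PebbleTree

variable {n : ℕ}

/-- The coordinate with index `j`. -/
def coord (n ℓ j : ℕ) : Coord n :=
  if h : ℓ ≤ j ∧ j / ℓ - 1 < n then (some ⟨j / ℓ - 1, h.2⟩, j % ℓ + 1) else (none, j)

/-- The index of a coordinate. -/
def index (ℓ : ℕ) : Coord n → ℕ
  | (none, j) => j
  | (some c, j) => ℓ * ((c : ℕ) + 1) + j - 1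

/-- The position of the block containing a coordinate. -/
def blockOf (b : ℕ) : Coord n → ℕ
  | (none, _) => 0
  | (some c, _) => (c : ℕ) + 1 - b

/-- Euclidean division by ℓ: quotient 0 gives the gaps, quotient c + 1 the colour c, with remainder
the leaf number minus 1. -/
theorem index_coord {ℓ j : ℕ} (hℓ : 1 ≤ ℓ) (hj : j ∈ Finset.Icc 1 (ℓ * (n + 1) - 1)) :
    coord n ℓ j ∈ (fullBox n 1 ℓ).coords ∧ index ℓ (coord n ℓ j) = j := by
  rw [Finset.mem_Icc] at hj
  have hlt : j / ℓ < n + 1 := by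
    rw [Nat.div_lt_iff_lt_mul (by omega), mul_comm]
    omega
  have hmod := Nat.mod_lt j (show ℓ > 0 by omega)
  unfold coord
  by_cases h : ℓ ≤ j
  · have h1 : 1 ≤ j / ℓ := (Nat.one_le_div_iff (by omega)).2 h
    rw [dif_pos ⟨h, by omega⟩, some_mem_fullBox]
    refine ⟨⟨by omega, by omega⟩, ?_⟩
    simp only [index]
    rw [Nat.sub_add_cancel h1]
    have := Nat.div_add_mod j ℓ
    omega
  · rw [dif_neg fun h' => h h'.1, none_mem_fullBox]
    exact ⟨⟨by omega, by omega⟩, rfl⟩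

theorem coord_index {ℓ : ℕ} (hℓ : 1 ≤ ℓ) {q : Coord n} (hq : q ∈ (fullBox n 1 ℓ).coords) :
    index ℓ q ∈ Finset.Icc 1 (ℓ * (n + 1) - 1) ∧ coord n ℓ (index ℓ q) = q := by
  obtain ⟨_ | c, j⟩ := q
  · rw [none_mem_fullBox] at hq
    simp only [index, Finset.mem_Icc]
    have : ℓ * 1 ≤ ℓ * (n + 1) := Nat.mul_le_mul_left _ (by omega)
    refine ⟨by omega, ?_⟩
    unfold coord
    rw [dif_neg]
    omega
  · rw [some_mem_fullBox] at hq
    simp only [index, Finset.mem_Icc]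
    have h₁ : ℓ * ((c : ℕ) + 1 + 1) ≤ ℓ * (n + 1) := Nat.mul_le_mul_left _ (by omega)
    have h₂ : ℓ * 1 ≤ ℓ * ((c : ℕ) + 1) := Nat.mul_le_mul_left _ (by omega)
    have h₃ := mul_add_one ℓ ((c : ℕ) + 1)
    refine ⟨by omega, ?_⟩
    have he : ℓ * ((c : ℕ) + 1) + j - 1 = (j - 1) + ℓ * ((c : ℕ) + 1) := by omega
    have hdiv : (ℓ * ((c : ℕ) + 1) + j - 1) / ℓ = (c : ℕ) + 1 := by
      rw [he, Nat.add_mul_div_left _ _ (by omega), Nat.div_eq_of_lt (by omega), zero_add]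
    have hmod : (ℓ * ((c : ℕ) + 1) + j - 1) % ℓ = j - 1 := by
      rw [he, Nat.add_mul_mod_self_left, Nat.mod_eq_of_lt (by omega)]
    unfold coord
    rw [dif_pos ⟨by omega, by rw [hdiv]; omega⟩]
    simp only [hdiv, hmod, Nat.add_sub_cancel]
    rw [Nat.sub_add_cancel hq.1]

theorem eq_of_mul_add_close {ℓ a a' x y : ℕ} (hx : x < ℓ) (hy : y < ℓ)
    (h : ℓ * a + x = ℓ * a' + y) : a = a' := by
  rcases lt_trichotomy a a' with h' | h' | h'
  · have : ℓ * (a + 1) ≤ ℓ * a' := Nat.mul_le_mul_left _ h'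
    rw [mul_add_one] at this
    omega
  · exact h'
  · have : ℓ * (a' + 1) ≤ ℓ * a := Nat.mul_le_mul_left _ h'
    rw [mul_add_one] at this
    omega

/-- A nonempty box inside the leaves `1, …, ℓ`. -/
def Box.Fits (τ : Box n) (ℓ : ℕ) : Prop :=
  1 ≤ τ.start ∧ 1 ≤ τ.len ∧ τ.start + τ.len ≤ 1 + ℓ

/-- The set of indices of the coordinates of a box. -/
def Box.indices (τ : Box n) (ℓ : ℕ) : Finset ℕ :=
  box ℓ τ.start (τ.start + τ.len - 1) τ.colors

/-- Fitting inside the leaves 1, …, ℓ keeps the intervals of distinct colours, and the gaps, from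
overlapping. -/
theorem index_mem_indices {ℓ : ℕ} {τ : Box n} (hτ : τ.Fits ℓ) {q : Coord n}
    (hq : q ∈ (fullBox n 1 ℓ).coords) : index ℓ q ∈ τ.indices ℓ ↔ q ∈ τ.coords := by
  obtain ⟨h₁, h₂, h₃⟩ := hτ
  simp only [Box.indices, box, Finset.mem_union, Finset.mem_Icc, Finset.mem_biUnion]
  obtain ⟨_ | c, j⟩ := q
  · rw [none_mem_fullBox] at hq
    rw [Box.none_mem_coords]
    simp only [index]
    constructor
    · rintro (h | ⟨c, -, h, -⟩)
      · omega
      · have : ℓ * 1 ≤ ℓ * ((c : ℕ) + 1) := Nat.mul_le_mul_left _ (by omega)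
        omega
    · intro h
      left
      omega
  · rw [some_mem_fullBox] at hq
    rw [Box.some_mem_coords]
    simp only [index]
    have h₄ : ℓ * 1 ≤ ℓ * ((c : ℕ) + 1) := Nat.mul_le_mul_left _ (by omega)
    constructor
    · rintro (h | ⟨d, hd, h, h'⟩)
      · omega
      · have hcd : (c : ℕ) + 1 = (d : ℕ) + 1 := by
          refine eq_of_mul_add_close (ℓ := ℓ) (x := j - 1)
            (y := ℓ * ((c : ℕ) + 1) + j - 1 - ℓ * ((d : ℕ) + 1)) (by omega) (by omega) (by omega)
        obtain rfl : c = d := Fin.ext (by omega)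
        exact ⟨hd, by omega, by omega⟩
    · rintro ⟨hc, h, h'⟩
      exact Or.inr ⟨c, hc, by omega, by omega⟩

-- The blocks `I_i`, and the linear map from coordinates to the ambient space.

variable {ℓ b u : ℕ}

/-- Truncated subtraction in `blockOf` puts every colour c < b in block 0 with the gaps; each
remaining colour is a block of its own. -/
theorem index_mem_block {q : Coord (b + u)} (hq : q ∈ (fullBox (b + u) 1 ℓ).coords) {i : ℕ} :
    index ℓ q ∈ block ℓ b i ↔ blockOf b q = i := by
  obtain ⟨_ | c, j⟩ := q
  · rw [none_mem_fullBox] at hq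
    simp only [index, blockOf, block]
    have h₁ : ℓ * 1 ≤ ℓ * (b + 1) := Nat.mul_le_mul_left _ (by omega)
    split_ifs with hi
    · subst hi
      simp only [Finset.mem_Icc, iff_true]
      omega
    · have h₂ : ℓ * 1 ≤ ℓ * (b + i) := Nat.mul_le_mul_left _ (by omega)
      simp only [Finset.mem_Icc]
      omega
  · rw [some_mem_fullBox] at hq
    have h₀ : ℓ * 1 ≤ ℓ * ((c : ℕ) + 1) := Nat.mul_le_mul_left _ (by omega)
    simp only [index, blockOf, block]
    split_ifs with hi
    · subst hi
      simp only [Finset.mem_Icc]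
      constructor
      · intro h
        by_contra hc
        have : ℓ * (b + 1) ≤ ℓ * ((c : ℕ) + 1) := Nat.mul_le_mul_left _ (by omega)
        omega
      · intro h
        have : ℓ * ((c : ℕ) + 1 + 1) ≤ ℓ * (b + 1) := Nat.mul_le_mul_left _ (by omega)
        rw [mul_add_one] at this
        omega
    · simp only [Finset.mem_Icc]
      have h₁ := mul_add_one ℓ (b + i)
      constructor
      · intro h
        have : (c : ℕ) + 1 = b + i := eq_of_mul_add_close (ℓ := ℓ) (x := j - 1)
          (y := ℓ * ((c : ℕ) + 1) + j - 1 - ℓ * (b + i)) (by omega) (by omega) (by omega)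
        omega
      · intro h
        have : (c : ℕ) + 1 = b + i := by omega
        rw [this] at h₀ ⊢
        omega

theorem blockOf_le (q : Coord (b + u)) : blockOf b q ≤ u := by
  obtain ⟨_ | c, j⟩ := q
  · simp [blockOf]
  · simp only [blockOf]; omega

theorem block_subset (hℓ : 1 ≤ ℓ) {i : ℕ} (hi : i ≤ u) :
    block ℓ b i ⊆ Finset.Icc 1 (ℓ * (b + u + 1) - 1) := by
  intro j hj
  have h₁ : ℓ * (b + i + 1) ≤ ℓ * (b + u + 1) := Nat.mul_le_mul_left _ (by omega)
  unfold block at hj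
  split_ifs at hj with h0
  · subst h0
    rw [Finset.mem_Icc] at hj ⊢
    simp only [add_zero] at h₁
    omega
  · have h₂ : 1 * 1 ≤ ℓ * (b + i) := Nat.mul_le_mul hℓ (by omega)
    rw [Finset.mem_Icc] at hj ⊢
    omega

theorem mem_block_iff (hℓ : 1 ≤ ℓ) {j i : ℕ} (hj : j ∈ Finset.Icc 1 (ℓ * (b + u + 1) - 1)) :
    j ∈ block ℓ b i ↔ blockOf b (coord (b + u) ℓ j) = i := by
  obtain ⟨h₁, h₂⟩ := index_coord (n := b + u) hℓ hj
  rw [← index_mem_block h₁, h₂]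

/-- The linear map sending the characteristic vectors of boxes to the rays. -/
noncomputable def toSpace (ℓ b u : ℕ) : (Coord (b + u) → ℝ) →ₗ[ℝ] (Idx ℓ b u → ℝ) where
  toFun X k := ((block ℓ b (blockOf b (coord (b + u) ℓ k))).card : ℝ) * X (coord (b + u) ℓ k) -
    ∑ j ∈ block ℓ b (blockOf b (coord (b + u) ℓ k)), X (coord (b + u) ℓ j)
  map_add' X Y := by
    funext k
    simp only [Pi.add_apply, Finset.sum_add_distrib]
    ring
  map_smul' a X := by
    funext k
    simp only [Pi.smul_apply, smul_eq_mul, ← Finset.mul_sum, RingHom.id_apply]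
    ring

theorem toSpace_apply (X : Coord (b + u) → ℝ) (k : Idx ℓ b u) {i : ℕ}
    (hi : blockOf b (coord (b + u) ℓ k) = i) :
    toSpace ℓ b u X k = ((block ℓ b i).card : ℝ) * X (coord (b + u) ℓ k) -
      ∑ j ∈ block ℓ b i, X (coord (b + u) ℓ j) := by
  subst hi; rfl

theorem ind_coord (hℓ : 1 ≤ ℓ) {τ : Box n} (hτ : τ.Fits ℓ) {j : ℕ}
    (hj : j ∈ Finset.Icc 1 (ℓ * (n + 1) - 1)) :
    τ.ind (coord n ℓ j) = if j ∈ τ.indices ℓ then 1 else 0 := by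
  obtain ⟨h₁, h₂⟩ := index_coord (n := n) hℓ hj
  have h := index_mem_indices hτ h₁
  rw [h₂] at h
  split_ifs with h'
  · exact Box.ind_of_mem (h.1 h')
  · exact Box.ind_of_notMem fun h'' => h' (h.2 h'')

/-- On the block `I_i` the image is |I_i| 𝟙_J − |I_i ∩ J|, that is |I_i ∖ J| on J and −|I_i ∩ J| off
J. -/
theorem toSpace_ind (hℓ : 1 ≤ ℓ) {τ : Box (b + u)} (hτ : τ.Fits ℓ) :
    toSpace ℓ b u τ.ind = ray ℓ b u (τ.indices ℓ) := by
  funext k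
  set J := τ.indices ℓ with hJ
  set i := blockOf b (coord (b + u) ℓ k) with hi
  have hiu : i ≤ u := blockOf_le _
  have hk : (k : ℕ) ∈ block ℓ b i := (mem_block_iff hℓ k.2).2 hi.symm
  rw [toSpace_apply _ k hi.symm, ind_coord hℓ hτ k.2, ← hJ,
    Finset.sum_congr rfl fun j hj => ind_coord hℓ hτ (block_subset hℓ hiu hj), ← hJ,
    Finset.sum_ite_mem, Finset.sum_const, nsmul_eq_mul, mul_one]
  have hcard : ((block ℓ b i).card : ℝ) = (block ℓ b i \ J).card + (block ℓ b i ∩ J).card := by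
    exact_mod_cast (Finset.card_sdiff_add_card_inter _ _).symm
  simp only [ray, Finset.sum_apply, Pi.sub_apply, Pi.smul_apply, smul_eq_mul, charVec,
    Finset.mem_inter, Finset.mem_sdiff]
  rw [Finset.sum_eq_single i]
  · rw [hcard]
    by_cases hkJ : (k : ℕ) ∈ J <;> simp [hk, hkJ]
  · intro i' _ hne
    have : (k : ℕ) ∉ block ℓ b i' := fun h => hne ((mem_block_iff hℓ k.2).1 h).symm
    simp [this]
  · intro h
    simp at h
    omega

theorem charVec_dotProduct (hℓ : 1 ≤ ℓ) {i : ℕ} (hi : i ≤ u) (x : Idx ℓ b u → ℝ) (f : ℕ → ℝ)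
    (hf : ∀ k : Idx ℓ b u, blockOf b (coord (b + u) ℓ k) = i → f k = x k) :
    charVec ℓ b u (block ℓ b i) ⬝ᵥ x = ∑ j ∈ block ℓ b i, f j := by
  have h : ∀ k : Idx ℓ b u, charVec ℓ b u (block ℓ b i) k * x k =
      if (k : ℕ) ∈ block ℓ b i then f k else 0 := by
    intro k
    simp only [charVec]
    split_ifs with hk
    · rw [one_mul, hf k ((mem_block_iff hℓ k.2).1 hk)]
    · rw [zero_mul]
  simp only [dotProduct, h]
  rw [Finset.sum_coe_sort (Finset.Icc 1 (ℓ * (b + u + 1) - 1))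
    fun j => if j ∈ block ℓ b i then f j else 0, Finset.sum_ite_mem,
    Finset.inter_eq_right.2 (block_subset hℓ hi)]

theorem toSpace_mem (hℓ : 1 ≤ ℓ) (X : Coord (b + u) → ℝ) : toSpace ℓ b u X ∈ space ℓ b u := by
  intro i hi
  rw [charVec_dotProduct hℓ hi _ (fun j => ((block ℓ b i).card : ℝ) * X (coord (b + u) ℓ j) -
    ∑ j ∈ block ℓ b i, X (coord (b + u) ℓ j)) fun k hk => (toSpace_apply X k hk).symm]
  rw [Finset.sum_sub_distrib, ← Finset.mul_sum, Finset.sum_const, nsmul_eq_mul, sub_self]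

/-- Surjectivity onto the space with one free constant `μ i` per block: the constants are killed,
and the coordinates of x sum to zero on each block. -/
theorem toSpace_eq_of_mem (hℓ : 1 ≤ ℓ) {x : Idx ℓ b u → ℝ} (hx : x ∈ space ℓ b u)
    {X : Coord (b + u) → ℝ} {μ : ℕ → ℝ}
    (hX : ∀ k : Idx ℓ b u, X (coord (b + u) ℓ k) =
      x k / (block ℓ b (blockOf b (coord (b + u) ℓ k))).card - μ (blockOf b (coord (b + u) ℓ k))) :
    toSpace ℓ b u X = x := by
  funext k
  set i := blockOf b (coord (b + u) ℓ k) with hi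
  have hiu : i ≤ u := blockOf_le _
  have hcard : ((block ℓ b i).card : ℝ) ≠ 0 := by
    have := Finset.card_pos.2 ⟨(k : ℕ), (mem_block_iff hℓ k.2).2 hi.symm⟩
    positivity
  have hsum := hx i hiu
  rw [charVec_dotProduct hℓ hiu x
    (fun j => (block ℓ b i).card * (X (coord (b + u) ℓ j) + μ i)) ?_] at hsum
  · rw [← Finset.mul_sum, Finset.sum_add_distrib, Finset.sum_const, nsmul_eq_mul,
      mul_eq_zero, or_iff_right hcard] at hsum
    rw [toSpace_apply X k hi.symm, hX k, ← hi]
    have : (block ℓ b i).card * (x k / (block ℓ b i).card) = x k := mul_div_cancel₀ _ hcard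
    linarith
  · intro k' hk'
    rw [hX k', hk']
    field_simp
    ring

theorem eq_of_toSpace_eq_zero (hℓ : 1 ≤ ℓ) {X : Coord (b + u) → ℝ} (h : toSpace ℓ b u X = 0)
    {q q' : Coord (b + u)} (hq : q ∈ (fullBox (b + u) 1 ℓ).coords)
    (hq' : q' ∈ (fullBox (b + u) 1 ℓ).coords) (hqq' : blockOf b q = blockOf b q') :
    X q = X q' := by
  obtain ⟨h₁, h₂⟩ := coord_index hℓ hq
  obtain ⟨h₁', h₂'⟩ := coord_index hℓ hq'
  have e := congrFun h (⟨index ℓ q, h₁⟩ : Idx ℓ b u)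
  have e' := congrFun h (⟨index ℓ q', h₁'⟩ : Idx ℓ b u)
  rw [toSpace_apply X _ (i := blockOf b q) (by rw [h₂]), h₂, Pi.zero_apply] at e
  rw [toSpace_apply X _ (i := blockOf b q) (by rw [h₂', hqq']), h₂', Pi.zero_apply] at e'
  have hcard : ((block ℓ b (blockOf b q)).card : ℝ) ≠ 0 := by
    have := Finset.card_pos.2 ⟨index ℓ q, (index_mem_block hq).2 rfl⟩
    positivity
  exact mul_left_cancel₀ hcard (by linarith)

theorem toSpace_eq_zero (hℓ : 1 ≤ ℓ) {X : Coord (b + u) → ℝ} (a : ℕ → ℝ)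
    (h : ∀ q ∈ (fullBox (b + u) 1 ℓ).coords, X q = a (blockOf b q)) : toSpace ℓ b u X = 0 := by
  funext k
  have hc : ∀ j ∈ Finset.Icc 1 (ℓ * (b + u + 1) - 1),
      X (coord (b + u) ℓ j) = a (blockOf b (coord (b + u) ℓ j)) :=
    fun j hj => h _ (index_coord hℓ hj).1
  rw [toSpace_apply X k rfl, hc k k.2, Finset.sum_congr rfl fun j hj => ?_, Finset.sum_const,
    nsmul_eq_mul, sub_self, Pi.zero_apply]
  rw [hc j (block_subset hℓ (blockOf_le _) hj),
    (mem_block_iff hℓ (block_subset hℓ (blockOf_le _) hj)).1 hj]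

end PebbleTree

/-! ### The pebble tree fan -/

namespace PTree

theorem IsSubtreeAt.range {κ : Type} {T S : PTree κ} {s t : ℕ} (h : T.IsSubtreeAt s S t) :
    s ≤ t ∧ t + S.leaves ≤ s + T.leaves := by
  induction h with
  | refl T s => exact ⟨le_rfl, le_rfl⟩
  | child h ih =>
    simp only [leaves, List.map_append, List.map_cons, List.sum_append, List.sum_cons]
    omega

theorem IsSubtreeAt.isPebbleTree {κ : Type} {T S : PTree κ} {s t : ℕ} (h : T.IsSubtreeAt s S t)
    (hT : T.IsPebbleTree) : S.IsPebbleTree := by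
  induction h with
  | refl T s => exact hT
  | child h ih =>
    rw [IsPebbleTree] at hT
    exact ih (hT.2.2.2 _ (by simp))

end PTree

namespace PebbleTree

variable {ℓ b u : ℕ}

/-- The colours for which a pebble tree is balanced. -/
def rootColors (b u : ℕ) : Finset (Fin (b + u)) := Finset.univ.filter fun c => (c : ℕ) < b

theorem balanced_eq_rootColors (T : PebbleTree ℓ b u) : balanced T.1 = rootColors b u := by
  ext c
  rw [mem_balanced, T.2.2.2 c, rootColors]
  split_ifs with h <;> simp [h]

theorem boxOf_eq (T : PebbleTree ℓ b u) : boxOf T.1 1 = ⟨1, ℓ, rootColors b u⟩ := by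
  rw [boxOf, T.2.2.1, balanced_eq_rootColors]

theorem mem_rootBox {q : Coord (b + u)} :
    q ∈ (⟨1, ℓ, rootColors b u⟩ : Box (b + u)).coords ↔
      q ∈ (fullBox (b + u) 1 ℓ).coords ∧ blockOf b q = 0 := by
  obtain ⟨_ | c, j⟩ := q
  · rw [none_mem_fullBox, Box.none_mem_coords]
    simp [blockOf]
  · rw [some_mem_fullBox, Box.some_mem_coords]
    simp only [rootColors, Finset.mem_filter, Finset.mem_univ, true_and, blockOf]
    omega

/-- The ray of a box. -/
noncomputable def boxRay (ℓ b u : ℕ) (τ : Box (b + u)) : Idx ℓ b u → ℝ :=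
  ray ℓ b u (τ.indices ℓ)

open Classical in
/-- The boxes of the nodes of a pebble tree distinct from its root. -/
noncomputable def nodeBoxes (T : PebbleTree ℓ b u) : Finset (Box (b + u)) :=
  (properBoxes T.1 1).toFinset

theorem mem_nodeBoxes {T : PebbleTree ℓ b u} {τ : Box (b + u)} :
    τ ∈ nodeBoxes T ↔ τ ∈ properBoxes T.1 1 := by
  simp [nodeBoxes]

theorem properBoxes_subset {n : ℕ} (T : PTree (Fin n)) (s : ℕ) : properBoxes T s ⊆ boxes T s := by
  cases T <;> simp [properBoxes, boxes]

theorem fits_of_isSubtreeAt (T : PebbleTree ℓ b u) {S : PTree (Fin (b + u))} {s : ℕ}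
    (h : T.1.IsSubtreeAt 1 S s) : (boxOf S s).Fits ℓ := by
  have h₁ := h.range
  rw [T.2.2.1] at h₁
  exact ⟨h₁.1, PTree.leaves_pos (h.isPebbleTree T.2.1), h₁.2⟩

theorem fits_of_mem_nodeBoxes {T : PebbleTree ℓ b u} {τ : Box (b + u)} (h : τ ∈ nodeBoxes T) :
    τ.Fits ℓ := by
  obtain ⟨S, s, hS, -, rfl⟩ := mem_boxes_iff.1 (properBoxes_subset _ _ (mem_nodeBoxes.1 h))
  exact fits_of_isSubtreeAt T hS

/-- The root box is exactly block 0, so its indicator is constant on every block. -/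
theorem boxRay_root (hℓ : 1 ≤ ℓ) : boxRay ℓ b u ⟨1, ℓ, rootColors b u⟩ = 0 := by
  rw [boxRay, ← toSpace_ind hℓ ⟨le_rfl, hℓ, le_rfl⟩]
  refine toSpace_eq_zero hℓ (fun i => if i = 0 then 1 else 0) fun q hq => ?_
  split_ifs with h
  · exact Box.ind_of_mem (mem_rootBox.2 ⟨hq, h⟩)
  · exact Box.ind_of_notMem fun h' => h (mem_rootBox.1 h').2

theorem boxRay_leaf (hℓ : 1 ≤ ℓ) {s : ℕ} (h : (boxOf (.leaf : PTree (Fin (b + u))) s).Fits ℓ) :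
    boxRay ℓ b u (boxOf .leaf s) = 0 := by
  rw [boxRay, ← toSpace_ind hℓ h]
  refine toSpace_eq_zero hℓ 0 fun q _ => Box.ind_of_notMem fun hq => ?_
  rw [boxOf, balanced_leaf, PTree.leaves] at hq
  obtain ⟨_ | c, j⟩ := q
  · rw [Box.none_mem_coords] at hq
    simp only at hq
    omega
  · simp [Box.some_mem_coords] at hq

/-- The generators of leaves and of the root vanish, leaving those of the other nodes. -/
theorem cone_eq_coneOf (hℓ : 1 ≤ ℓ) (T : PebbleTree ℓ b u) :
    T.cone = UniqueDecompositions.coneOf nodeBoxes (boxRay ℓ b u) T := by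
  refine le_antisymm (Submodule.span_le.2 ?_) (Submodule.span_mono ?_)
  · rintro _ ⟨S, s, hS, rfl⟩
    have hf := fits_of_isSubtreeAt T hS
    change boxRay ℓ b u (boxOf S s) ∈ UniqueDecompositions.coneOf nodeBoxes (boxRay ℓ b u) T
    by_cases hl : S = .leaf
    · subst hl
      rw [boxRay_leaf hℓ hf]
      exact zero_mem _
    · have hmem : boxOf S s ∈ boxes T.1 1 := mem_boxes_iff.2 ⟨S, s, hS, hl, rfl⟩
      have hT : T.1 ≠ .leaf := fun h => by rw [h] at hmem; simp [boxes] at hmem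
      rw [boxes_eq_cons hT, List.mem_cons, boxOf_eq] at hmem
      rcases hmem with hmem | hmem
      · rw [hmem, boxRay_root hℓ]
        exact zero_mem _
      · exact Submodule.subset_span (Set.mem_image_of_mem _ (mem_nodeBoxes.2 hmem))
  · rintro _ ⟨τ, hτ, rfl⟩
    obtain ⟨S, s, hS, -, rfl⟩ := mem_boxes_iff.1 (properBoxes_subset _ _ (mem_nodeBoxes.1 hτ))
    exact ⟨S, s, hS, rfl⟩

theorem fan_eq (hℓ : 1 ≤ ℓ) :
    fan ℓ b u = Set.range (UniqueDecompositions.coneOf (nodeBoxes (ℓ := ℓ)) (boxRay ℓ b u)) := by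
  unfold fan
  congr 1
  funext T
  exact cone_eq_coneOf hℓ T

/-- The proper boxes of a pebble tree leave a coordinate uncovered in each block. -/
theorem exists_wsum_properBoxes_eq_zero (T : PebbleTree ℓ b u) (hT : T.1 ≠ .leaf)
    (w : Box (b + u) → ℝ) {q : Coord (b + u)} (hq : q ∈ (fullBox (b + u) 1 ℓ).coords) :
    ∃ q' ∈ (fullBox (b + u) 1 ℓ).coords, blockOf b q' = blockOf b q ∧
      wsum (properBoxes T.1 1) w q' = 0 := by
  have hroot := boxOf_eq T
  have hbal := balanced_eq_rootColors T
  obtain ⟨T, hP, hl, hd⟩ := T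
  cases T with
  | leaf => exact absurd rfl hT
  | node p cs =>
    simp only at hroot hbal ⊢
    rw [properBoxes]
    -- Block 0 is the root box, which the proper boxes never cover; any other block is a colour
    -- unbalanced at the root, hence in some child.
    by_cases h0 : blockOf b q = 0
    · obtain ⟨q', hq', hz⟩ := exists_mem_coords_wsum_eq_zero hP 1 w
      rw [hroot, mem_rootBox] at hq'
      exact ⟨q', hq'.1, hq'.2.trans h0.symm, hz⟩
    · obtain ⟨_ | c, j⟩ := q
      · exact absurd rfl h0
      · have hc : c ∉ balanced (PTree.node p cs) := by
          simp only [blockOf] at h0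
          simp only [hbal, rootColors, Finset.mem_filter, Finset.mem_univ, true_and]
          omega
        obtain ⟨C, hC, hCc⟩ := exists_child_unbalanced (p := p) (c := c)
          (by rw [(notMem_balanced hP).1 hc]; omega)
        rw [PTree.IsPebbleTree] at hP
        obtain ⟨i, h₁, h₂, h₃⟩ := exists_wsum_boxesList_eq_zero hP.2.2.2 hC hCc 1 w
        rw [PTree.leaves] at hl
        exact ⟨(some c, i), some_mem_fullBox.2 ⟨h₁, by omega⟩, rfl, h₃⟩

theorem wsum_properBoxes_eq_zero (T : PebbleTree ℓ b u) (w : Box (b + u) → ℝ)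
    {q : Coord (b + u)} (hq : q ∉ (fullBox (b + u) 1 ℓ).coords) :
    wsum (properBoxes T.1 1) w q = 0 := by
  obtain ⟨T, hP, hl, hd⟩ := T
  cases T with
  | leaf => simp [properBoxes, wsum_nil]
  | node p cs =>
    rw [PTree.leaves] at hl
    exact wsum_boxesList_eq_zero w (hl ▸ hq)

/-- Number of leaves and balanced colours depend only on ℓ, b and u, and they detect the leaf. -/
theorem eq_leaf_of_eq_leaf {T T' : PebbleTree ℓ b u} (hT : T.1 = .leaf) : T'.1 = .leaf := by
  refine leaf_eq_of_balanced T'.2.1 ?_ ?_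
  · rw [T'.2.2.1, ← T.2.2.1, hT, PTree.leaves]
  · rw [balanced_eq_rootColors, ← balanced_eq_rootColors T, hT, balanced_leaf]

/-- Positive combinations of proper boxes are distinct modulo the kernel of `toSpace`. -/
theorem eq_of_toSpace_wsum (hℓ : 1 ≤ ℓ) {T T' : PebbleTree ℓ b u} {w w' : Box (b + u) → ℝ}
    (hw : ∀ τ ∈ properBoxes T.1 1, 0 < w τ) (hw' : ∀ τ ∈ properBoxes T'.1 1, 0 < w' τ)
    (h : toSpace ℓ b u (wsum (properBoxes T.1 1) w) =
      toSpace ℓ b u (wsum (properBoxes T'.1 1) w')) :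
    T = T' ∧ ∀ τ ∈ properBoxes T.1 1, w τ = w' τ := by
  by_cases hT : T.1 = .leaf
  · refine ⟨Subtype.ext (hT.trans (eq_leaf_of_eq_leaf hT).symm), ?_⟩
    rw [hT]
    simp [properBoxes]
  have hT' : T'.1 ≠ .leaf := fun h' => hT (eq_leaf_of_eq_leaf h')
  have hX : wsum (properBoxes T.1 1) w = wsum (properBoxes T'.1 1) w' := by
    funext q
    by_cases hq : q ∈ (fullBox (b + u) 1 ℓ).coords
    -- The difference of the two vectors is constant on the block of q; it is at most 0 at a zero of
    -- the first and at least 0 at a zero of the second.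
    · obtain ⟨q₁, hq₁, hb₁, hz₁⟩ := exists_wsum_properBoxes_eq_zero T hT w hq
      obtain ⟨q₂, hq₂, hb₂, hz₂⟩ := exists_wsum_properBoxes_eq_zero T' hT' w' hq
      rw [← sub_eq_zero, ← map_sub] at h
      have e₁ := eq_of_toSpace_eq_zero hℓ h hq₁ hq hb₁
      have e₂ := eq_of_toSpace_eq_zero hℓ h hq₂ hq hb₂
      simp only [Pi.sub_apply, hz₁, hz₂] at e₁ e₂
      have := wsum_nonneg hw' q₁
      have := wsum_nonneg hw q₂
      linarith
    · rw [wsum_properBoxes_eq_zero T w hq, wsum_properBoxes_eq_zero T' w' hq]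
  have hb : balanced T.1 = balanced T'.1 := by
    rw [balanced_eq_rootColors, balanced_eq_rootColors]
  have hl : T.1.leaves = T'.1.leaves := T.2.2.1.trans T'.2.2.1.symm
  obtain ⟨T, hP, hTl, hTd⟩ := T
  obtain ⟨T', hP', hTl', hTd'⟩ := T'
  cases T with
  | leaf => exact absurd rfl hT
  | node p cs =>
    cases T' with
    | leaf => exact absurd rfl hT'
    | node p' cs' =>
      simp only [properBoxes] at hX hw hw' ⊢
      have hQ := hP
      have hQ' := hP'
      rw [PTree.IsPebbleTree] at hQ hQ'
      obtain ⟨rfl, hww⟩ := eq_of_wsum_boxesList (fun C _ => determinedBy C) hQ.2.2.2 hQ'.2.2.2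
        hw hw' (by simpa only [PTree.leaves] using hl) hX
      obtain rfl := node_eq_node hP hP' hb
      exact ⟨rfl, hww⟩

-- Dividing by multiplicities passes from the finset to the list of boxes without proving that
-- distinct nodes have distinct boxes.
open Classical in
theorem sum_nodeBoxes (hℓ : 1 ≤ ℓ) (T : PebbleTree ℓ b u) (w : Box (b + u) → ℝ) :
    ∑ τ ∈ nodeBoxes T, w τ • boxRay ℓ b u τ = toSpace ℓ b u
      (wsum (properBoxes T.1 1) fun τ => w τ / (properBoxes T.1 1).count τ) := by
  rw [wsum, Finset.sum_list_map_count, map_sum]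
  refine Finset.sum_congr rfl fun τ hτ => ?_
  have hc : ((properBoxes T.1 1).count τ : ℝ) ≠ 0 := by
    have := List.count_pos_iff.2 (mem_nodeBoxes.1 hτ)
    positivity
  rw [map_nsmul, map_smul, toSpace_ind hℓ (fits_of_mem_nodeBoxes hτ), ← Nat.cast_smul_eq_nsmul ℝ,
    smul_smul, mul_div_cancel₀ _ hc, boxRay]

theorem nodeBoxes_mono {S T : PebbleTree ℓ b u} (h : S ≤ T) : nodeBoxes S ⊆ nodeBoxes T :=
  fun _ hτ => mem_nodeBoxes.2 (properBoxes_subset_of_contractions h 1 (mem_nodeBoxes.1 hτ))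

theorem exists_le_nodeBoxes_eq (T : PebbleTree ℓ b u) (X : Finset (Box (b + u)))
    (hX : X ⊆ nodeBoxes T) : ∃ S ≤ T, nodeBoxes S = X := by
  obtain ⟨S, hS, hm⟩ := exists_contractions T.1 1 X fun τ hτ => mem_nodeBoxes.1 (hX hτ)
  obtain ⟨h₁, h₂, h₃⟩ := pebble_of_contractions hS T.2.1
  refine ⟨⟨S, h₁, h₂.trans T.2.2.1, fun c => (h₃ c).trans (T.2.2.2 c)⟩, hS, ?_⟩
  ext τ
  exact mem_nodeBoxes.trans (hm τ)

theorem uniqueDecompositions (hℓ : 1 ≤ ℓ) :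
    UniqueDecompositions (nodeBoxes (ℓ := ℓ) (b := b) (u := u)) (boxRay ℓ b u) where
  mono _ _ h := nodeBoxes_mono h
  exists_le := exists_le_nodeBoxes_eq
  unique S T w w' hw hw' h := by
    classical
    rw [sum_nodeBoxes hℓ, sum_nodeBoxes hℓ] at h
    have hpos : ∀ (T : PebbleTree ℓ b u), ∀ τ ∈ properBoxes T.1 1,
        (0 : ℝ) < (properBoxes T.1 1).count τ := fun T τ hτ => by
      exact_mod_cast List.count_pos_iff.2 hτ
    obtain ⟨rfl, hww⟩ := eq_of_toSpace_wsum hℓ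
      (fun τ hτ => div_pos (hw τ (mem_nodeBoxes.2 hτ)) (by exact_mod_cast hpos S τ hτ))
      (fun τ hτ => div_pos (hw' τ (mem_nodeBoxes.2 hτ)) (by exact_mod_cast hpos T τ hτ)) h
    refine ⟨rfl, fun τ hτ => ?_⟩
    have h₁ := hpos S τ (mem_nodeBoxes.1 hτ)
    have h₂ := hww τ (mem_nodeBoxes.1 hτ)
    exact (div_left_inj' (by exact_mod_cast h₁.ne')).1 h₂

/-- Only finitely many boxes fit in the leaves 1, …, ℓ, so the trees themselves need not be counted.
-/
theorem finite_range_nodeBoxes : (Set.range (nodeBoxes (ℓ := ℓ) (b := b) (u := u))).Finite := by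
  have hfin : {τ : Box (b + u) | τ.Fits ℓ}.Finite := by
    refine Set.Finite.of_finite_image (f := fun τ => (τ.start, τ.len, τ.colors)) ?_
      fun τ _ σ _ h => by
        simp only [Prod.mk.injEq] at h
        exact Box.ext h.1 h.2.1 h.2.2
    refine ((Set.finite_Iic ℓ).prod ((Set.finite_Iic ℓ).prod Set.finite_univ)).subset ?_
    rintro _ ⟨τ, ⟨h₁, h₂, h₃⟩, rfl⟩
    simp only [Set.mem_prod, Set.mem_Iic, Set.mem_univ, and_true]
    omega
  refine (hfin.toFinset.powerset.finite_toSet).subset ?_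
  rintro _ ⟨T, rfl⟩
  rw [Finset.mem_coe, Finset.mem_powerset]
  exact fun τ hτ => hfin.mem_toFinset.2 (fits_of_mem_nodeBoxes hτ)

theorem coneOf_subset_space (hℓ : 1 ≤ ℓ) (T : PebbleTree ℓ b u) {x : Idx ℓ b u → ℝ}
    (hx : x ∈ UniqueDecompositions.coneOf nodeBoxes (boxRay ℓ b u) T) : x ∈ space ℓ b u := by
  obtain ⟨w, -, rfl⟩ := PointedCone.mem_hull_image_finset.1 hx
  rw [sum_nodeBoxes hℓ]
  exact toSpace_mem hℓ _

theorem toSpace_mem_coneOf (hℓ : 1 ≤ ℓ) (T : PebbleTree ℓ b u) {X : Coord (b + u) → ℝ}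
    (hX : X ∈ boxCone (properBoxes T.1 1)) :
    toSpace ℓ b u X ∈ UniqueDecompositions.coneOf nodeBoxes (boxRay ℓ b u) T := by
  have hset : {τ | τ ∈ properBoxes T.1 1} = (nodeBoxes T : Set (Box (b + u))) := by
    ext τ
    simp [mem_nodeBoxes]
  rw [boxCone, hset] at hX
  obtain ⟨w, hw, rfl⟩ := PointedCone.mem_hull_image_finset.1 hX
  refine PointedCone.mem_hull_image_finset.2 ⟨w, hw, ?_⟩
  rw [map_sum]
  refine Finset.sum_congr rfl fun τ hτ => ?_
  rw [map_smul, toSpace_ind hℓ (fits_of_mem_nodeBoxes hτ), boxRay]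

/-- Lift x by dividing by block sizes and subtracting the minimum of each block. The lift is
nonnegative with a zero in each nonempty block, exactly what `exists_pebbleTree` needs. -/
theorem exists_mem_coneOf (hℓ : 1 ≤ ℓ) {x : Idx ℓ b u → ℝ} (hx : x ∈ space ℓ b u) :
    ∃ T : PebbleTree ℓ b u, x ∈ UniqueDecompositions.coneOf nodeBoxes (boxRay ℓ b u) T := by
  classical
  set A : Set (Coord (b + u)) := (fullBox (b + u) 1 ℓ).coords with hA
  let Z : Coord (b + u) → ℝ := fun q =>
    if h : index ℓ q ∈ Finset.Icc 1 (ℓ * (b + u + 1) - 1) then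
      x ⟨index ℓ q, h⟩ / (block ℓ b (blockOf b q)).card else 0
  have hmin : ∀ i, ∃ μ : ℝ, (∀ q ∈ A, blockOf b q = i → μ ≤ Z q) ∧
      ((∃ q ∈ A, blockOf b q = i) → ∃ q ∈ A, blockOf b q = i ∧ Z q = μ) := by
    intro i
    rcases Set.eq_empty_or_nonempty {q | q ∈ A ∧ blockOf b q = i} with he | hne
    · have : ∀ q ∈ A, blockOf b q ≠ i := fun q hq hqi =>
        (Set.eq_empty_iff_forall_notMem.1 he q) ⟨hq, hqi⟩
      -- A block may be empty, for instance block 0 when ℓ = 1 and b = 0; its constant is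
      -- irrelevant.
      exact ⟨0, fun q hq hqi => absurd hqi (this q hq),
        fun ⟨q, hq, hqi⟩ => absurd hqi (this q hq)⟩
    · obtain ⟨q, hq, hqm⟩ := Set.exists_min_image _ Z
        ((finite_coords _).subset fun q (hq : q ∈ A ∧ blockOf b q = i) => hq.1) hne
      exact ⟨Z q, fun q' h h' => hqm q' ⟨h, h'⟩, fun _ => ⟨q, hq.1, hq.2, rfl⟩⟩
  choose μ hμ hμ' using hmin
  set X : Coord (b + u) → ℝ := A.indicator fun q => Z q - μ (blockOf b q) with hXdef
  have hXA : ∀ q ∈ A, X q = Z q - μ (blockOf b q) := fun q hq => Set.indicator_of_mem hq _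
  have hX : SupportedOn 1 ℓ X :=
    ⟨Set.indicator_nonneg fun q hq => sub_nonneg.2 (hμ _ q hq rfl), Set.support_indicator_subset⟩
  have hzero : ∀ q ∈ A, ∃ q' ∈ A, blockOf b q' = blockOf b q ∧ X q' = 0 := by
    intro q hq
    obtain ⟨q', h₁, h₂, h₃⟩ := hμ' (blockOf b q) ⟨q, hq, rfl⟩
    exact ⟨q', h₁, h₂, by rw [hXA q' h₁, h₂, h₃, sub_self]⟩
  obtain ⟨T, hP, hl, hbal, hXT⟩ := exists_pebbleTree (B := rootColors b u) hℓ hX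
    (fun ⟨q, hq⟩ => by
      rw [mem_rootBox] at hq
      obtain ⟨q', h₁, h₂, h₃⟩ := hzero q hq.1
      exact ⟨q', mem_rootBox.2 ⟨h₁, h₂.trans hq.2⟩, h₃⟩)
    (fun c hc => by
      have hcb : b ≤ (c : ℕ) := by simpa [rootColors] using hc
      -- The block of an unbalanced colour c contains that colour only, so its zero is at a leaf in
      -- colour c.
      obtain ⟨⟨_ | d, j⟩, h₁, h₂, h₃⟩ := hzero (some c, 1) (some_mem_fullBox.2 ⟨le_rfl, by omega⟩)
      · simp only [blockOf] at h₂
        omega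
      · simp only [blockOf] at h₂
        obtain rfl : d = c := Fin.ext (by omega)
        rw [hA, some_mem_fullBox] at h₁
        exact ⟨j, h₁.1, h₁.2, h₃⟩)
  refine ⟨⟨T, hP, hl, fun c => ?_⟩, ?_⟩
  · have hc : c ∈ balanced T ↔ (c : ℕ) < b := by rw [hbal]; simp [rootColors]
    split_ifs with h
    · exact mem_balanced.1 (hc.2 h)
    · exact (notMem_balanced hP).1 fun h' => h (hc.1 h')
  · rw [← toSpace_eq_of_mem hℓ hx (X := X) (μ := μ)]
    · exact toSpace_mem_coneOf hℓ _ hXT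
    · intro k
      obtain ⟨h₁, h₂⟩ := index_coord (n := b + u) hℓ k.2
      rw [hXA _ h₁]
      simp only [Z, h₂, k.2, dite_true]

theorem isCompleteIn (hℓ : 1 ≤ ℓ) :
    IsCompleteIn (Set.range (UniqueDecompositions.coneOf (nodeBoxes (ℓ := ℓ)) (boxRay ℓ b u)))
      (space ℓ b u) := by
  refine Set.Subset.antisymm (Set.iUnion₂_subset ?_) fun x hx => ?_
  · rintro _ ⟨T, rfl⟩ x hx
    exact coneOf_subset_space hℓ T hx
  · obtain ⟨T, hT⟩ := exists_mem_coneOf hℓ hx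
    exact Set.mem_iUnion₂.2 ⟨_, ⟨T, rfl⟩, hT⟩

end PebbleTree

theorem mainTheorem2 (ℓ b u : ℕ) (hℓ : 1 ≤ ℓ) :
    IsFan (PebbleTree.fan ℓ b u) ∧
    IsEssentialFan (PebbleTree.fan ℓ b u) ∧
    IsCompleteIn (PebbleTree.fan ℓ b u) (PebbleTree.space ℓ b u) ∧
    IsSimplicialFan (PebbleTree.fan ℓ b u) ∧
    ∃ e : PebbleTree ℓ b u ≃o ↥(PebbleTree.fan ℓ b u),
      ∀ T : PebbleTree ℓ b u, (e T : PointedCone ℝ (PebbleTree.Idx ℓ b u → ℝ)) = T.cone := by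
  have h := PebbleTree.uniqueDecompositions (b := b) (u := u) hℓ
  -- Completeness at the origin provides a pebble tree; essentiality needs the poset to be nonempty.
  obtain ⟨T, -⟩ := PebbleTree.exists_mem_coneOf hℓ (PebbleTree.space ℓ b u).zero_mem
  simp only [PebbleTree.cone_eq_coneOf hℓ]
  rw [PebbleTree.fan_eq hℓ]
  exact ⟨h.isFan PebbleTree.finite_range_nodeBoxes, h.isEssentialFan T,
    PebbleTree.isCompleteIn hℓ, h.isSimplicialFan, h.exists_orderIso⟩
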